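/- Let $n\ge 1$, let $U$ be a connected open neighbourhood of $0\in\mathbb R^n$, and let $L$ be a finite-dimensional solvable real Lie algebra of smooth vector fields on $U$ which is transitive, i.e. the vectors $X(x)$, $X\in L$, span $T_x\mathbb R^n$ for every $x\in U$. Let $\mathfrak{nr}(L)$ be the nilradical (the largest nilpotent ideal) of $L$ and let $$L^0=L,\qquad L^1=\mathfrak{nr}(L),\qquad L^{i+1}=[\mathfrak{nr}(L),L^i]\quad(i\ge 1)$$ be the nilradical series; let $k$ be the smallest integer with $L^{k+1}=\{0\}$. Let $V^i$ be the distribution spanned by the vector fields in $L^i$, let $\mathcal F^i$ be the foliation tangent to $V^i$, and let $\dim\mathcal F^i$ be the rank of $V^i$ at $0$. Let $r_1<\dots<r_m$ be the indices $i$ with $\dim\mathcal F^{i+1}<\dim\mathcal F^i$, and put $r_{m+1}=k+1$ (so that $\mathcal F^{r_{m+1}}$ is the foliation by points), $a_i=\dim\mathcal F^{r_i}-\dim\mathcal F^{r_i+1}$, $b_0=0$, $b_j=a_1+\dots+a_j$. Then $b_{m-1}=n-a_m$, and there are smooth coordinates $y=(y^1,\dots,y^n)$, centred at $0$, on a neighbourhood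 $W\subset U$ of $0$, with $y(W)=(-\varepsilon,\varepsilon)^n$ for some $\varepsilon>0$, such that the following hold. 1. For each $j=1,\dots,m$ the coordinates $y^1,\dots,y^{b_j}$ define $\mathcal F^{r_{j+1}}$ on $W$ as their level sets: at each $p\in W$, $V^{r_{j+1}}(p)$ is the common kernel of $dy^1,\dots,dy^{b_j}$, and the leaf through $p$ of the foliation $\mathcal F^{r_{j+1}}$ of $W$ (the points reached from $p$ along piecewise $C^1$ curves in $W$ tangent to $V^{r_{j+1}}$) is the set of $q\in W$ with $y^i(q)=y^i(p)$ for all $i\le b_j$. 2. There are $Y_1,\dots,Y_n\in L$ such that, for each $j=1,\dots,m$, the vector fields $Y_{b_{j-1}+1},\dots,Y_n$ generate $\mathcal F^{r_j}$ on $W$ (they span $V^{r_j}(p)$ at each $p\in W$), and for $b_{j-1}<i\le b_j$ $$Y_i=\partial_{y^i}\quad\text{mod } \mathcal F^{r_{j+1}},$$ i.e. $Y_i(p)-\partial_{y^i}(p)\in V^{r_{j+1}}(p)$ for all $p\in W$. 3. $\mathcal F^k$ is generated on $W$ by $Y_{b_{m-1}+1},\dots,Y_n$; these vector fields belong to $L^k$,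 and on $W$ $$Y_{b_{m-1}+1}=\partial_{y^{b_{m-1}+1}},\ \dots,\ Y_n=\partial_{y^n}.$$ 4. Every $X\in L$ can be written on $W$ as $$X=\sum_{j=b_{m-1}+1}^n\Big(\sum_{i=b_{m-1}+1}^n f_i^j(y^1,\dots,y^{b_{m-1}})\,y^i+g^j(y^1,\dots,y^{b_{m-1}})\Big)\partial_{y^j}+\bar X,\qquad \bar X=\sum_{i=1}^{b_{m-1}}v^i(y^1,\dots,y^{b_{m-1}})\,\partial_{y^i},$$ with smooth functions $f_i^j,g^j,v^i$ on $\bar U=(-\varepsilon,\varepsilon)^{b_{m-1}}$. If $X\in L^1$, then, with the same $\bar X$, $$X=\sum_{j=b_{m-1}+1}^n u^j(y^1,\dots,y^{b_{m-1}})\,\partial_{y^j}+\bar X$$ with smooth functions $u^j$ on $\bar U$. 5. Regarded as vector fields on the neighbourhood $\bar U$ of $0\in\mathbb R^{b_{m-1}}$, the $\bar X$ form a Lie algebra $\bar L$ of vector fields, and $X\mapsto\bar X$ is a Lie algebra homomorphism of $L$ onto $\bar L$. The algebra $\bar L$ is a solvable, finite-dimensional Lie algebra of vector fields in $b_{m-1}=n-a_m$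 variables, transitive on $\bar U$. -/

import Mathlib

open Set TopologicalSpace
open scoped Topology ContDiff

/-- Smooth vector fields on an open set `U` of `ℝⁿ`, as a real vector space. A field on `U` is
represented by its extension by zero outside `U`, so that equality means equality on `U`. -/
def smoothVFSubmodule {n : ℕ} (U : Opens (Fin n → ℝ)) :
    Submodule ℝ ((Fin n → ℝ) → (Fin n → ℝ)) where
  carrier := {X | ContDiffOn ℝ ∞ X U ∧ ∀ x ∉ U, X x = 0}
  add_mem' := fun hX hY => ⟨hX.1.add hY.1, fun x hx => by simp [hX.2 x hx, hY.2 x hx]⟩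
  zero_mem' := ⟨contDiffOn_const, fun _ _ => rfl⟩
  smul_mem' := fun c _ hX => ⟨contDiffOn_const.smul hX.1, fun x hx => by simp [hX.2 x hx]⟩

/-- The type of smooth vector fields on the open set `U`. -/
def SmoothVF {n : ℕ} (U : Opens (Fin n → ℝ)) : Type := ↥(smoothVFSubmodule U)

namespace SmoothVF

variable {n : ℕ} {U : Opens (Fin n → ℝ)}

noncomputable instance : AddCommGroup (SmoothVF U) :=
  inferInstanceAs (AddCommGroup ↥(smoothVFSubmodule U))

noncomputable instance : Module ℝ (SmoothVF U) :=
  inferInstanceAs (Module ℝ ↥(smoothVFSubmodule U))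

instance : CoeFun (SmoothVF U) (fun _ => (Fin n → ℝ) → (Fin n → ℝ)) := ⟨fun X => X.1⟩

theorem ext_on {X Y : SmoothVF U} (h : ∀ x ∈ U, X x = Y x) : X = Y := by
  apply Subtype.ext
  funext x
  by_cases hx : x ∈ U
  · exact h x hx
  · exact (X.2.2 x hx).trans (Y.2.2 x hx).symm

theorem contDiffAt (X : SmoothVF U) {x : Fin n → ℝ} (hx : x ∈ U) : ContDiffAt ℝ ∞ X x :=
  X.2.1.contDiffAt (U.isOpen.mem_nhds hx)

theorem differentiableAt (X : SmoothVF U) {x : Fin n → ℝ} (hx : x ∈ U) :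
    DifferentiableAt ℝ X x :=
  (X.contDiffAt hx).differentiableAt (by simp)

theorem add_coe (X Y : SmoothVF U) : ((X + Y : SmoothVF U) : (Fin n → ℝ) → (Fin n → ℝ)) = X + Y :=
  rfl

theorem smul_coe (c : ℝ) (X : SmoothVF U) :
    ((c • X : SmoothVF U) : (Fin n → ℝ) → (Fin n → ℝ)) = c • (X : (Fin n → ℝ) → (Fin n → ℝ)) := rfl

open Classical in
/-- The Lie bracket of vector fields, `[X, Y] = DY(X) - DX(Y)` on `U`. -/
noncomputable instance : Bracket (SmoothVF U) (SmoothVF U) where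
  bracket X Y :=
    ⟨fun x => if x ∈ U then VectorField.lieBracket ℝ X Y x else 0, by
      refine ⟨?_, fun x hx => if_neg hx⟩
      refine ContDiffOn.congr (f := VectorField.lieBracket ℝ X Y) (fun x hx => ?_)
        (fun x hx => if_pos hx)
      exact (ContDiffAt.lieBracket_vectorField (m := ∞) (n := ∞) (X.contDiffAt hx)
        (Y.contDiffAt hx) (by norm_cast)).contDiffWithinAt⟩

theorem bracket_apply (X Y : SmoothVF U) {x : Fin n → ℝ} (hx : x ∈ U) :
    ⁅X, Y⁆ x = VectorField.lieBracket ℝ X Y x := if_pos hx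

theorem bracket_eventuallyEq (X Y : SmoothVF U) {x : Fin n → ℝ} (hx : x ∈ U) :
    (⁅X, Y⁆ : SmoothVF U).1 =ᶠ[𝓝 x] VectorField.lieBracket ℝ X Y :=
  Filter.eventually_of_mem (U.isOpen.mem_nhds hx) (fun _ hz => bracket_apply X Y hz)

noncomputable instance : LieRing (SmoothVF U) where
  add_lie X Y Z := ext_on fun x hx => by
    rw [bracket_apply _ _ hx, add_coe, add_coe, Pi.add_apply, bracket_apply _ _ hx,
      bracket_apply _ _ hx]
    exact VectorField.lieBracket_add_left (X.differentiableAt hx) (Y.differentiableAt hx)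
  lie_add X Y Z := ext_on fun x hx => by
    rw [bracket_apply _ _ hx, add_coe, add_coe, Pi.add_apply, bracket_apply _ _ hx,
      bracket_apply _ _ hx]
    exact VectorField.lieBracket_add_right (Y.differentiableAt hx) (Z.differentiableAt hx)
  lie_self X := ext_on fun x hx => by
    rw [bracket_apply _ _ hx, VectorField.lieBracket_self]; rfl
  leibniz_lie X Y Z := ext_on fun x hx => by
    rw [add_coe, Pi.add_apply, bracket_apply _ _ hx, bracket_apply _ _ hx, bracket_apply _ _ hx,
      (Filter.EventuallyEq.refl _ _).lieBracket_vectorField_eq (bracket_eventuallyEq Y Z hx),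
      (bracket_eventuallyEq X Y hx).lieBracket_vectorField_eq (Filter.EventuallyEq.refl _ _),
      (Filter.EventuallyEq.refl _ _).lieBracket_vectorField_eq (bracket_eventuallyEq X Z hx)]
    exact VectorField.leibniz_identity_lieBracket (n := ∞)
      (by simp only [minSmoothness_of_isRCLikeNormedField]; exact WithTop.coe_le_coe.2 (le_top : (2 : ℕ∞) ≤ ⊤))
      (X.contDiffAt hx) (Y.contDiffAt hx) (Z.contDiffAt hx)

noncomputable instance : LieAlgebra ℝ (SmoothVF U) where
  lie_smul c X Y := ext_on fun x hx => by
    rw [bracket_apply _ _ hx, smul_coe, smul_coe, Pi.smul_apply, bracket_apply _ _ hx]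
    exact VectorField.lieBracket_const_smul_right (Y.differentiableAt hx)

/-- Evaluation of vector fields at a point. -/
def evalAt (x : Fin n → ℝ) : SmoothVF U →ₗ[ℝ] (Fin n → ℝ) where
  toFun X := X x
  map_add' _ _ := rfl
  map_smul' _ _ := rfl

end SmoothVF

/-- The nilradical of a Lie algebra: the sum of all ideals that are nilpotent as Lie algebras
(in finite dimension, the largest nilpotent ideal). -/
def lieNilradical (R L : Type*) [CommRing R] [LieRing L] [LieAlgebra R L] : LieIdeal R L :=
  sSup {I : LieIdeal R L | LieRing.IsNilpotent I}

/-- The nilradical series: `L⁰ = L`, `L¹ = nr(L)`, `Lⁱ⁺¹ = [nr(L), Lⁱ]` for `i ≥ 1`. -/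
def nilradicalSeries (R L : Type*) [CommRing R] [LieRing L] [LieAlgebra R L] : ℕ → LieIdeal R L
  | 0 => ⊤
  | 1 => lieNilradical R L
  | i + 2 => ⁅lieNilradical R L, nilradicalSeries R L (i + 1)⁆

namespace LocalVF

variable {n : ℕ} {U : Opens (Fin n → ℝ)}

/-- The value at `x` of the distribution spanned by the ideal `I` of `L`. -/
noncomputable def distributionOf {L : LieSubalgebra ℝ (SmoothVF U)} (I : LieIdeal ℝ L) (x : Fin n → ℝ) :
    Submodule ℝ (Fin n → ℝ) :=
  I.toSubmodule.map ((SmoothVF.evalAt x).comp L.toSubmodule.subtype)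

/-- `L` is transitive on `U`: its vector fields span the tangent space at every point of `U`. -/
def IsTransitive (L : LieSubalgebra ℝ (SmoothVF U)) : Prop :=
  ∀ x ∈ U, L.toSubmodule.map (SmoothVF.evalAt x) = ⊤

variable (L : LieSubalgebra ℝ (SmoothVF U))

/-- The ideals `Lⁱ` of the nilradical series of `L`. -/
noncomputable def ideal (i : ℕ) : LieIdeal ℝ L := nilradicalSeries ℝ L i

/-- The distribution `Vⁱ` spanned by `Lⁱ`, tangent to the foliation `𝓕ⁱ`. -/
noncomputable def V (i : ℕ) (x : Fin n → ℝ) : Submodule ℝ (Fin n → ℝ) := distributionOf (ideal L i) x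

/-- The last index `k` of the nilradical series: the smallest `k` with `Lᵏ⁺¹ = 0`. -/
noncomputable def height : ℕ := sInf {k | ideal L (k + 1) = ⊥}

/-- The dimension of (the leaves of) `𝓕ⁱ`, i.e. the rank of `Vⁱ`, computed at the origin. -/
noncomputable def dimF (i : ℕ) : ℕ := Module.finrank ℝ (V L i 0)

/-- The number `m` of indices `i` at which the dimension of `𝓕ⁱ⁺¹` is smaller than that of `𝓕ⁱ`. -/
noncomputable def m : ℕ := {i | dimF L (i + 1) < dimF L i}.ncard

/-- `r₁ < r₂ < ⋯ < r_m` are the indices at which the dimension drops, in increasing order, and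
`r_{m+1} = k + 1`, so that `𝓕` with index `r_{m+1}` is the foliation by points. (The value at `0`
is not used.) -/
noncomputable def r (j : ℕ) : ℕ :=
  if j ≤ m L then Nat.nth (fun i => dimF L (i + 1) < dimF L i) (j - 1) else height L + 1

/-- `a_j = dim 𝓕^{r_j} - dim 𝓕^{r_j + 1}`, for `1 ≤ j ≤ m`. -/
noncomputable def a (j : ℕ) : ℕ := dimF L (r L j) - dimF L (r L j + 1)

/-- `b_j = a_1 + ⋯ + a_j`, with `b_0 = 0`. -/
noncomputable def b (j : ℕ) : ℕ := ∑ i ∈ Finset.Icc 1 j, a L i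

/-- `p` and `q` are joined by a `C¹` curve in `W` which is tangent to the distribution `D`. -/
def TangentJoined (D : (Fin n → ℝ) → Submodule ℝ (Fin n → ℝ)) (W : Set (Fin n → ℝ))
    (p q : Fin n → ℝ) : Prop :=
  ∃ γ : ℝ → (Fin n → ℝ), ContDiffOn ℝ 1 γ (Icc 0 1) ∧ γ 0 = p ∧ γ 1 = q ∧
    ∀ t ∈ Icc (0 : ℝ) 1, γ t ∈ W ∧ derivWithin γ (Icc 0 1) t ∈ D (γ t)

/-- The leaf through `p ∈ W` of the foliation of `W` tangent to `D`: all points of `W` which are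
reached from `p` along piecewise `C¹` curves in `W` tangent to `D`. -/
def leaf (D : (Fin n → ℝ) → Submodule ℝ (Fin n → ℝ)) (W : Set (Fin n → ℝ)) (p : Fin n → ℝ) :
    Set (Fin n → ℝ) :=
  {q | q ∈ W ∧ Relation.EqvGen (TangentJoined D W) p q}

/-- The open cube `(-ε, ε)^d` (a ball for the sup norm). -/
def cube (d : ℕ) (ε : ℝ) : Opens (Fin d → ℝ) := ⟨Metric.ball 0 ε, Metric.isOpen_ball⟩

/-- `y` is a smooth coordinate system, centred at the origin and with image the cube `(-ε, ε)ⁿ`,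
on a neighbourhood of the origin contained in `U`. -/
structure IsCoordinates (U : Opens (Fin n → ℝ))
    (y : OpenPartialHomeomorph (Fin n → ℝ) (Fin n → ℝ)) (ε : ℝ) : Prop where
  pos : 0 < ε
  zero_mem : 0 ∈ y.source
  map_zero : y 0 = 0
  source_subset : y.source ⊆ U
  target_eq : y.target = cube n ε
  contDiffOn : ContDiffOn ℝ ∞ y y.source
  contDiffOn_symm : ContDiffOn ℝ ∞ y.symm y.target

/-- The coordinate vector field `∂_{yⁱ}` (indices start at `0`). -/
noncomputable def partialVF (y : OpenPartialHomeomorph (Fin n → ℝ) (Fin n → ℝ)) (i : Fin n)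
    (p : Fin n → ℝ) : Fin n → ℝ :=
  fderiv ℝ y.symm (y p) (Pi.single i 1)

/-- The first `d` entries of a vector in `ℝⁿ`. -/
def firstEntries {d : ℕ} (h : d ≤ n) (x : Fin n → ℝ) : Fin d → ℝ := fun i => x (Fin.castLE h i)

end LocalVF

/-! The algebraic input is that `[Lⁱ, Lⁱ] ⊆ Lⁱ⁺¹` for every `i ≥ 0`
(`lie_mem_nilradicalSeries_succ`). For `i = 0` this is `[L, L] ⊆ nr(L)`: by Lie's theorem over `ℂ`
the ad-nilpotent elements form a subspace containing all brackets, and by Engel's theorem this ideal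
is nilpotent. The same facts show that the nilradical series reaches zero.

The analytic input is `exists_flow`: the derivative of the time-`t` flow of `Y ∈ L` carries the
values of `X ∈ L` to those of `exp (-t ad Y) X`. This formula solves the variational equation
explicitly, which also yields smoothness of the flow. Flows therefore respect every ideal of `L`,
and the rank of its distribution does not grow along them. By transitivity and connectedness, an
ideal vanishing at one point is zero, so `Lᵏ` does not vanish at the origin.

Choose `Y₀, …, Y_{n-1}` in `L` whose values at `0` form a basis adapted to the flag `Vⁱ(0)`, each
`Y_i` taken in the deepest ideal possible, `L^{Q i}`. Compose their flows, that of `Y₀` being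
applied first, and use the times as coordinates. The coordinate field `∂_i` is `Y_i` transported by
flows of later `Y_l`. Since `[Y_l, Y_i] ∈ L^{Q i + 1}`, it is the value of an element of `Y_i + L^{Q
i + 1}`. Together with the rank bound, this shows that every `Vⁱ` is spanned near `0` both by a tail
of the `Y_i` and by the same tail of the `∂_i` (`exists_adapted_chart`). Statements 1 and 2 follow,
and statement 3 because the correction vanishes at level `k + 1`.

In this chart the last fields `Y_i = ∂_i` lie in `Lᵏ`, so differentiating the components of `X` in a
fibre direction amounts to bracketing with `Y_i`, and `[Y_i, X] ∈ Lᵏ`. Elements of `Lᵏ` have no base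
components and constant fibre components, since `[L¹, Lᵏ] = 0`. Hence base components descend and
fibre components are affine; for `X ∈ L¹` they are constant along the fibres (`FibredChart`). -/

/-! ### Elements acting nilpotently, by Lie's theorem. -/

section NilpotentElements

open LieModule TensorProduct

/-- For a finite-dimensional module over a solvable Lie algebra, the elements acting nilpotently
form a subspace which contains the derived algebra. -/
theorem exists_submodule_mem_iff_isNilpotent_toEnd (K L : Type*) [Field K] [IsAlgClosed K]
    [CharZero K] [LieRing L] [LieAlgebra K L] [LieAlgebra.IsSolvable L] (d : ℕ) :
    ∀ (M : Type*) [AddCommGroup M] [Module K M] [LieRingModule L M] [LieModule K L M]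
      [FiniteDimensional K M], Module.finrank K M = d →
    ∃ S : Submodule K L, (∀ x, x ∈ S ↔ IsNilpotent (toEnd K L M x)) ∧ ∀ x y : L, ⁅x, y⁆ ∈ S := by
  induction d with
  | zero =>
    intro M _ _ _ _ _ hd
    have : Subsingleton M := Module.finrank_zero_iff.1 hd
    exact ⟨⊤, fun x => ⟨fun _ => ⟨1, Subsingleton.elim _ _⟩, fun _ => trivial⟩, fun _ _ => trivial⟩
  | succ d ih =>
    intro M _ _ _ _ _ hd
    have : Nontrivial M := Module.nontrivial_of_finrank_pos (R := K) (by omega)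
    -- Lie's theorem gives a common eigenvector `v` of weight `χ`. An element acts nilpotently on
    -- `M` exactly when it does so on the quotient by the line of `v` and `χ` kills it; `χ` vanishes
    -- on brackets.
    obtain ⟨χ, hχ⟩ := exists_nontrivial_weightSpace_of_isSolvable K L M
    obtain ⟨⟨v, hv⟩, hv0⟩ := exists_ne (0 : weightSpace M χ)
    have hv0 : v ≠ 0 := by simpa using hv0
    rw [mem_weightSpace] at hv
    let N : LieSubmodule K L M :=
      { Submodule.span K {v} with
        lie_mem := by
          intro x m hm
          obtain ⟨c, rfl⟩ := Submodule.mem_span_singleton.1 hm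
          exact Submodule.mem_span_singleton.2 ⟨c * χ x, by rw [lie_smul, hv, smul_smul]⟩ }
    have hN : Module.finrank K (M ⧸ N) = d := by
      have h1 := Submodule.finrank_quotient_add_finrank (Submodule.span K {v})
      rw [finrank_span_singleton hv0, hd] at h1
      have h2 : Module.finrank K (M ⧸ N) = Module.finrank K (M ⧸ Submodule.span K {v}) := rfl
      omega
    obtain ⟨S, hS, hS'⟩ := ih (M ⧸ N) hN
    have hquot : ∀ (x : L) (j : ℕ) (w : M), (((toEnd K L M x) ^ j) w : M) ∈ N ↔
        ((toEnd K L (M ⧸ N) x) ^ j) (LieSubmodule.Quotient.mk w) = 0 := by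
      intro x j w
      have : ∀ j, ((toEnd K L (M ⧸ N) x) ^ j) (LieSubmodule.Quotient.mk w) =
          LieSubmodule.Quotient.mk (((toEnd K L M x) ^ j) w) := by
        intro j
        induction j with
        | zero => rfl
        | succ j ihj => rw [pow_succ', pow_succ', Module.End.mul_apply, Module.End.mul_apply, ihj]; rfl
      rw [this]
      exact (LieSubmodule.Quotient.mk_eq_zero (N := N)).symm
    have hpow : ∀ (x : L) (j : ℕ), ((toEnd K L M x) ^ j) v = χ x ^ j • v := by
      intro x j
      induction j with
      | zero => simp
      | succ j ihj => rw [pow_succ', Module.End.mul_apply, ihj, map_smul, toEnd_apply_apply, hv, smul_smul, pow_succ]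
    refine ⟨S ⊓ LinearMap.ker χ, fun x => ⟨fun hx => ?_, fun hx => ⟨?_, ?_⟩⟩, fun x y => ⟨hS' x y, ?_⟩⟩
    · obtain ⟨j, hj⟩ := (hS x).1 hx.1
      refine ⟨j + 1, LinearMap.ext fun w => ?_⟩
      have hw : (((toEnd K L M x) ^ j) w : M) ∈ N := (hquot x j w).2 (by rw [hj]; rfl)
      obtain ⟨c, hc⟩ := Submodule.mem_span_singleton.1 hw
      have hx2 : χ x = 0 := hx.2
      rw [pow_succ', Module.End.mul_apply, ← hc, map_smul, toEnd_apply_apply, hv, hx2]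
      simp
    · obtain ⟨j, hj⟩ := hx
      refine (hS x).2 ⟨j, LinearMap.ext fun w => ?_⟩
      obtain ⟨w, rfl⟩ := LieSubmodule.Quotient.surjective_mk' N w
      exact (hquot x j w).1 (by rw [hj]; exact N.zero_mem)
    · obtain ⟨j, hj⟩ := hx
      have := hpow x j
      rw [hj] at this
      have h3 : χ x ^ j = 0 := by
        rcases smul_eq_zero.1 this.symm with h | h
        · exact h
        · exact absurd h hv0
      exact LinearMap.mem_ker.2 (eq_zero_of_pow_eq_zero h3)
    · have h1 : ⁅⁅x, y⁆, v⁆ = (0 : M) := by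
        rw [lie_lie, hv y, hv x, lie_smul, lie_smul, hv, hv, smul_smul, smul_smul, mul_comm, sub_self]
      rw [hv] at h1
      exact LinearMap.mem_ker.2 ((smul_eq_zero.1 h1).resolve_right hv0)

/-- In a finite-dimensional real solvable Lie algebra, the ad-nilpotent elements form a subspace
which contains the derived algebra. -/
theorem exists_submodule_mem_iff_isNilpotent_ad (L : Type*) [LieRing L] [LieAlgebra ℝ L]
    [FiniteDimensional ℝ L] [LieAlgebra.IsSolvable L] :
    ∃ S : Submodule ℝ L, (∀ x, x ∈ S ↔ IsNilpotent (LieAlgebra.ad ℝ L x)) ∧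
      ∀ x y : L, ⁅x, y⁆ ∈ S := by
  -- Eigenvectors require `ℂ`; base change of endomorphisms is an injective ring homomorphism, so it
  -- preserves and reflects nilpotency.
  obtain ⟨S, hS, hS'⟩ := exists_submodule_mem_iff_isNilpotent_toEnd ℂ (ℂ ⊗[ℝ] L) _ (ℂ ⊗[ℝ] L) rfl
  refine ⟨(S.restrictScalars ℝ).comap (TensorProduct.mk ℝ ℂ L 1), fun x => ?_, fun x y => ?_⟩
  · rw [Submodule.mem_comap, Submodule.restrictScalars_mem, hS, TensorProduct.mk_apply,
      toEnd_baseChange]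
    have hinj : Function.Injective (Module.End.baseChangeHom ℝ ℂ L) := by
      intro f g hfg
      refine LinearMap.ext fun v => ?_
      have h := LinearMap.congr_fun hfg (1 ⊗ₜ v)
      have h' : (1 : ℂ) ⊗ₜ[ℝ] (f v) = 1 ⊗ₜ (g v) := h
      exact Module.FaithfullyFlat.tensorProduct_mk_injective (A := ℝ) (B := ℂ) L h'
    exact IsNilpotent.map_iff (f := Module.End.baseChangeHom ℝ ℂ L) hinj
  · have h := hS' (1 ⊗ₜ x) (1 ⊗ₜ y)
    rw [Submodule.mem_comap, Submodule.restrictScalars_mem, TensorProduct.mk_apply]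
    simpa using h

end NilpotentElements

/-! ### The nilradical and its series. -/

section NilradicalSeries

variable {L : Type*} [LieRing L] [LieAlgebra ℝ L]

theorem isNilpotent_ad_of_mem {I : LieIdeal ℝ L} (hI : LieRing.IsNilpotent I) {x : L}
    (hx : x ∈ I) : IsNilpotent (LieAlgebra.ad ℝ L x) := by
  obtain ⟨j, hj⟩ := LieModule.isNilpotent_toEnd_of_isNilpotent ℝ I I ⟨x, hx⟩
  have hpow : ∀ (i : ℕ) (w : I), ((LieAlgebra.ad ℝ L x) ^ i) (w : L) =
      (((LieModule.toEnd ℝ I I ⟨x, hx⟩) ^ i) w : I) := by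
    intro i w
    induction i with
    | zero => rfl
    | succ i ih => rw [pow_succ', pow_succ', Module.End.mul_apply, Module.End.mul_apply, ih]; rfl
  -- The extra application of `ad x` moves `L` into `I`, where `j` further ones give zero.
  refine ⟨j + 1, LinearMap.ext fun w => ?_⟩
  have hxw : ⁅x, w⁆ ∈ I := lie_mem_left ℝ L I x w hx
  rw [pow_succ, Module.End.mul_apply, LieAlgebra.ad_apply, hpow j ⟨_, hxw⟩, hj]
  rfl

theorem nilradicalSeries_antitone : Antitone (nilradicalSeries ℝ L) := by
  refine antitone_nat_of_succ_le fun i => ?_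
  rcases i with _ | i
  · exact le_top
  · exact LieSubmodule.lie_le_right _ _

variable [FiniteDimensional ℝ L]

/-- Engel's theorem, applied to the restrictions of the `ad x` to `I`. -/
theorem isNilpotent_of_forall_isNilpotent_ad {I : LieIdeal ℝ L}
    (h : ∀ x ∈ I, IsNilpotent (LieAlgebra.ad ℝ L x)) : LieRing.IsNilpotent I := by
  rw [LieAlgebra.isNilpotent_iff_forall (R := ℝ)]
  rintro ⟨x, hx⟩
  obtain ⟨j, hj⟩ := h x hx
  have hpow : ∀ (i : ℕ) (w : I), ((LieAlgebra.ad ℝ L x) ^ i) (w : L) =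
      (((LieAlgebra.ad ℝ I ⟨x, hx⟩) ^ i) w : I) := by
    intro i w
    induction i with
    | zero => rfl
    | succ i ih => rw [pow_succ', pow_succ', Module.End.mul_apply, Module.End.mul_apply, ih]; rfl
  refine ⟨j, LinearMap.ext fun w => Subtype.ext ?_⟩
  rw [← hpow, hj]
  rfl

variable [LieAlgebra.IsSolvable L]

/-- Each nilpotent ideal consists of ad-nilpotent elements; these form an ideal, so it also contains
the supremum. Nilpotency of a sum of nilpotent ideals is not needed. -/
theorem isNilpotent_ad_of_mem_lieNilradical {x : L} (hx : x ∈ lieNilradical ℝ L) :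
    IsNilpotent (LieAlgebra.ad ℝ L x) := by
  obtain ⟨S, hS, hS'⟩ := exists_submodule_mem_iff_isNilpotent_ad L
  let T : LieIdeal ℝ L := { S with lie_mem := fun {x m} _ => hS' x m }
  have : lieNilradical ℝ L ≤ T := sSup_le fun I hI x hx => (hS x).2 (isNilpotent_ad_of_mem hI hx)
  exact (hS x).1 (this hx)

/-- The ad-nilpotent elements form an ideal containing all brackets, and Engel's theorem makes it
one of the nilpotent ideals defining the nilradical. -/
theorem lie_mem_lieNilradical (x y : L) : ⁅x, y⁆ ∈ lieNilradical ℝ L := by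
  obtain ⟨S, hS, hS'⟩ := exists_submodule_mem_iff_isNilpotent_ad L
  let T : LieIdeal ℝ L := { S with lie_mem := fun {x m} _ => hS' x m }
  have : T ≤ lieNilradical ℝ L :=
    le_sSup (isNilpotent_of_forall_isNilpotent_ad fun x hx => (hS x).1 hx)
  exact this (hS' x y)

/-- Level zero rests on solvability, through `[L, L] ⊆ nr(L)`; from level one on, the first factor
already lies in the nilradical. -/
theorem lie_mem_nilradicalSeries_succ {i : ℕ} {x y : L} (hx : x ∈ nilradicalSeries ℝ L i)
    (hy : y ∈ nilradicalSeries ℝ L i) : ⁅x, y⁆ ∈ nilradicalSeries ℝ L (i + 1) := by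
  rcases i with _ | i
  · exact lie_mem_lieNilradical x y
  · exact LieSubmodule.lie_mem_lie (nilradicalSeries_antitone (by omega : 1 ≤ i + 1) hx) hy

/-- By Engel's theorem the nilradical acts nilpotently on all of `L`, and the series lies below the
lower central series of this module, with indices shifted by one. -/
theorem exists_nilradicalSeries_eq_bot : ∃ i, nilradicalSeries ℝ L (i + 1) = ⊥ := by
  have h : LieModule.IsNilpotent (lieNilradical ℝ L) L :=
    (LieModule.isNilpotent_iff_forall' (R := ℝ)).2 fun x => isNilpotent_ad_of_mem_lieNilradical x.2
  obtain ⟨j, hj⟩ := (LieModule.isNilpotent_iff ℝ (lieNilradical ℝ L) L).1 h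
  have hle : ∀ i, nilradicalSeries ℝ L (i + 1) ≤ (lieNilradical ℝ L).lcs L i := by
    intro i
    induction i with
    | zero => exact le_top
    | succ i ih =>
      rw [LieIdeal.lcs_succ]
      exact LieSubmodule.mono_lie_right _ ih
  refine ⟨j, eq_bot_iff.2 ((hle j).trans ?_)⟩
  intro x hx
  have hx' : x ∈ ((lieNilradical ℝ L).lcs L j).toSubmodule := hx
  rw [LieIdeal.coe_lcs_eq, hj] at hx'
  exact hx'

/-- A zero nilradical would make `L` abelian, hence its own nilradical. This is what gives `k ≥ 1`.
-/
theorem nilradicalSeries_one_ne_bot [Nontrivial L] : nilradicalSeries ℝ L 1 ≠ ⊥ := by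
  intro h
  have habel : ∀ x y : L, ⁅x, y⁆ = 0 := fun x y => by
    have := lie_mem_lieNilradical x y
    rwa [show lieNilradical ℝ L = ⊥ from h] at this
  have htop : (⊤ : LieIdeal ℝ L) ≤ lieNilradical ℝ L :=
    le_sSup (isNilpotent_of_forall_isNilpotent_ad fun x _ => ⟨1, LinearMap.ext fun y => by
      simpa using habel x y⟩)
  rw [show lieNilradical ℝ L = ⊥ from h] at htop
  obtain ⟨x, hx⟩ := exists_ne (0 : L)
  exact hx (htop trivial)

end NilradicalSeries

/-! ### Differentiability of a flow from the variational equation. -/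

section Flow

variable {Q E F : Type*} [NormedAddCommGroup Q] [NormedSpace ℝ Q] [NormedAddCommGroup E]
  [NormedSpace ℝ E] [NormedAddCommGroup F] [NormedSpace ℝ F]

/-- A solution of a total differential equation with smooth right-hand side is smooth. -/
theorem contDiffOn_of_hasFDerivAt_comp {Ω : Set Q} (hΩ : IsOpen Ω) {φ : Q → E}
    {G : Q × E → Q →L[ℝ] E} (hG : ∀ q ∈ Ω, ContDiffAt ℝ ∞ G (q, φ q))
    (hφ : ∀ q ∈ Ω, HasFDerivAt φ (G (q, φ q)) q) : ContDiffOn ℝ ∞ φ Ω := by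
  rw [contDiffOn_infty]
  intro j
  induction j with
  | zero => exact contDiffOn_zero.2 fun q hq => (hφ q hq).continuousAt.continuousWithinAt
  -- Bootstrap: if `φ` is of class `Cʲ`, so is its derivative `q ↦ G (q, φ q)`.
  | succ j ih =>
    rw [Nat.cast_add, Nat.cast_one, contDiffOn_succ_iff_fderiv_of_isOpen hΩ]
    refine ⟨fun q hq => (hφ q hq).differentiableAt.differentiableWithinAt, fun h => ?_, ?_⟩
    · exact absurd h (by simp)
    · refine ContDiffOn.congr (f := fun q => G (q, φ q)) (fun q hq => ?_)
        fun q hq => (hφ q hq).fderiv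
      exact ContDiffAt.comp_contDiffWithinAt q ((hG q hq).of_le (by exact_mod_cast le_top))
        (contDiffWithinAt_id.prodMk (ih q hq))

/-- Second order Taylor estimate on a convex set where the derivative is Lipschitz. -/
theorem norm_image_sub_sub_fderiv_le {Y : E → E} {s : Set E} (hs : Convex ℝ s) {M : NNReal}
    (hY : ∀ z ∈ s, DifferentiableAt ℝ Y z) (hM : LipschitzOnWith M (fderiv ℝ Y) s)
    {z z' : E} (hz : z ∈ s) (hz' : z' ∈ s) :
    ‖Y z' - Y z - fderiv ℝ Y z (z' - z)‖ ≤ M * ‖z' - z‖ ^ 2 := by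
  have hsub : segment ℝ z z' ⊆ s := hs.segment_subset hz hz'
  have := (convex_segment (𝕜 := ℝ) z z').norm_image_sub_le_of_norm_fderiv_le' (𝕜 := ℝ) (f := Y)
    (φ := fderiv ℝ Y z) (C := M * ‖z' - z‖) (fun x hx => hY x (hsub hx)) (fun x hx => ?_)
    (left_mem_segment ℝ z z') (right_mem_segment ℝ z z')
  · rwa [mul_assoc, ← sq] at this
  · refine (hM.norm_sub_le (hsub hx) hz).trans ?_
    gcongr
    obtain ⟨a, b, ha, hb, hab, rfl⟩ := hx
    have : a • z + b • z' - z = b • (z' - z) := by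
      rw [show a = 1 - b by linarith]; module
    rw [this, norm_smul, Real.norm_of_nonneg hb]
    exact mul_le_of_le_one_left (norm_nonneg _) (by linarith)

/-- The flow of a vector field is differentiable as soon as the variational equation along it has
a bounded solution. -/
theorem hasFDerivAt_flow {Y : E → E} {φ : ℝ × E → E} {W : E → ℝ → E →L[ℝ] E} {x₀ : E}
    {ρ δ C : ℝ} {K M : NNReal} (hδ : δ ≤ 1)
    (hφ0 : ∀ x ∈ Metric.ball x₀ δ, φ (0, x) = x)
    (hφ : ∀ t ∈ Metric.ball (0 : ℝ) δ, ∀ x ∈ Metric.ball x₀ δ,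
      HasDerivAt (fun s => φ (s, x)) (Y (φ (t, x))) t)
    (hball : ∀ t ∈ Metric.ball (0 : ℝ) δ, ∀ x ∈ Metric.ball x₀ δ, φ (t, x) ∈ Metric.ball x₀ (ρ / 2))
    (hYd : ∀ z ∈ Metric.ball x₀ ρ, DifferentiableAt ℝ Y z)
    (hK : LipschitzOnWith K Y (Metric.ball x₀ ρ))
    (hM : LipschitzOnWith M (fderiv ℝ Y) (Metric.ball x₀ ρ))
    (hYC : ∀ z ∈ Metric.ball x₀ ρ, ‖Y z‖ ≤ C)
    (hDC : ∀ z ∈ Metric.ball x₀ ρ, ‖fderiv ℝ Y z‖ ≤ C)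
    (hW0 : ∀ x ∈ Metric.ball x₀ δ, W x 0 = ContinuousLinearMap.id ℝ E)
    (hW : ∀ t ∈ Metric.ball (0 : ℝ) δ, ∀ x ∈ Metric.ball x₀ δ,
      HasDerivAt (W x) ((fderiv ℝ Y (φ (t, x))).comp (W x t)) t)
    (hWC : ∀ t ∈ Metric.ball (0 : ℝ) δ, ∀ x ∈ Metric.ball x₀ δ, ‖W x t‖ ≤ C)
    {t : ℝ} {x : E} (ht : t ∈ Metric.ball (0 : ℝ) δ) (hx : x ∈ Metric.ball x₀ δ) :
    HasFDerivAt φ ((ContinuousLinearMap.fst ℝ ℝ E).smulRight (Y (φ (t, x))) +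
      (W x t).comp (ContinuousLinearMap.snd ℝ ℝ E)) (t, x) := by
  have hδ0 : 0 < δ := Metric.pos_of_mem_ball ht
  have hρ0 : 0 < ρ / 2 := Metric.pos_of_mem_ball (hball t ht x hx)
  have hballρ : Metric.ball x₀ (ρ / 2) ⊆ Metric.ball x₀ ρ := Metric.ball_subset_ball (by linarith)
  have hC0 : 0 ≤ C := (norm_nonneg _).trans (hWC t ht x hx)
  -- Trajectories are rescaled to the parameter interval `[0, 1]`, so that endpoints at the
  -- different times `t` and `t'` can be compared by one Gronwall estimate.
  have hsc : ∀ r ∈ Metric.ball (0 : ℝ) δ, ∀ s ∈ Icc (0 : ℝ) 1, s * r ∈ Metric.ball (0 : ℝ) δ := by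
    intro r hr s hs
    rw [mem_ball_zero_iff, Real.norm_eq_abs] at hr ⊢
    rw [abs_mul, abs_of_nonneg hs.1]
    exact (mul_le_of_le_one_left (abs_nonneg _) hs.2).trans_lt hr
  have hφs : ∀ r ∈ Metric.ball (0 : ℝ) δ, ∀ y ∈ Metric.ball x₀ δ, ∀ s ∈ Icc (0 : ℝ) 1,
      HasDerivAt (fun s => φ (s * r, y)) (r • Y (φ (s * r, y))) s := by
    intro r hr y hy s hs
    have h1 : HasDerivAt (fun s : ℝ => s * r) r s := by simpa using (hasDerivAt_id s).mul_const r
    exact HasDerivAt.scomp s (hφ _ (hsc r hr s hs) y hy) h1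
  have hWs : ∀ s ∈ Icc (0 : ℝ) 1, HasDerivAt (fun s => W x (s * t))
      (t • (fderiv ℝ Y (φ (s * t, x))).comp (W x (s * t))) s := by
    intro s hs
    have h1 : HasDerivAt (fun s : ℝ => s * t) t s := by simpa using (hasDerivAt_id s).mul_const t
    exact HasDerivAt.scomp s (hW _ (hsc t ht s hs) x hx) h1
  set A := (ContinuousLinearMap.fst ℝ ℝ E).smulRight (Y (φ (t, x))) +
      (W x t).comp (ContinuousLinearMap.snd ℝ ℝ E) with hA
  -- The defect of the approximate trajectory `p + w` below is at most `C' * N ^ 2`: the first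
  -- summand bounds the Taylor remainder of `Y` for a displacement `‖w‖ ≤ 2 * C * N`, the second the
  -- change of speed `τ` times `DY(w)`.
  set C' : ℝ := M * (2 * C) ^ 2 + C * (2 * C) with hC'
  have hC'0 : 0 ≤ C' := by positivity
  have key : ∀ᶠ q in 𝓝 ((t, x) : ℝ × E), ‖φ q - φ (t, x) - A (q - (t, x))‖ ≤
      gronwallBound 0 K C' 1 * ‖q - (t, x)‖ ^ 2 := by
    have e1 : ∀ᶠ q in 𝓝 ((t, x) : ℝ × E), q.1 ∈ Metric.ball (0 : ℝ) δ :=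
      continuousAt_fst.eventually (Metric.isOpen_ball.mem_nhds ht)
    have e2 : ∀ᶠ q in 𝓝 ((t, x) : ℝ × E), q.2 ∈ Metric.ball x₀ δ :=
      continuousAt_snd.eventually (Metric.isOpen_ball.mem_nhds hx)
    have e3 : ∀ᶠ q in 𝓝 ((t, x) : ℝ × E), 2 * C * ‖q - (t, x)‖ < ρ / 2 := by
      have : ContinuousAt (fun q : ℝ × E => 2 * C * ‖q - (t, x)‖) (t, x) := by fun_prop
      exact this.eventually_lt continuousAt_const (by simpa using hρ0)
    filter_upwards [e1, e2, e3] with q hq1 hq2 hq3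
    obtain ⟨t', x'⟩ := q
    set τ := t' - t with hτ
    set h := x' - x with hh
    set N := ‖((t', x') : ℝ × E) - (t, x)‖ with hN
    have hNτ : |τ| ≤ N := norm_fst_le ((t', x') - (t, x) : ℝ × E)
    have hNh : ‖h‖ ≤ N := norm_snd_le ((t', x') - (t, x) : ℝ × E)
    have hN0 : 0 ≤ N := norm_nonneg _
    have ht'1 : |t'| ≤ 1 := by
      have : |t'| < δ := by simpa using hq1
      linarith
    let p : ℝ → E := fun s => φ (s * t, x)
    -- The displacement predicted to first order; at `s = 1` it is `A` applied to the increment, and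
    -- at `s = 0` it is `h`, the exact difference of the initial points.
    let w : ℝ → E := fun s => (s * τ) • Y (p s) + W x (s * t) h
    have hp : ∀ s ∈ Icc (0 : ℝ) 1, p s ∈ Metric.ball x₀ (ρ / 2) := fun s hs =>
      hball _ (hsc t ht s hs) x hx
    have hw : ∀ s ∈ Icc (0 : ℝ) 1, ‖w s‖ ≤ 2 * C * N := by
      intro s hs
      have h1 : ‖(s * τ) • Y (p s)‖ ≤ N * C := by
        rw [norm_smul, Real.norm_eq_abs, abs_mul, abs_of_nonneg hs.1]
        have : s * |τ| ≤ N := (mul_le_of_le_one_left (abs_nonneg _) hs.2).trans hNτ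
        exact mul_le_mul this (hYC _ (hballρ (hp s hs))) (norm_nonneg _) hN0
      have h2 : ‖W x (s * t) h‖ ≤ C * N :=
        ((W x (s * t)).le_opNorm h).trans
          (mul_le_mul (hWC _ (hsc t ht s hs) x hx) hNh (norm_nonneg _) hC0)
      calc ‖w s‖ ≤ _ := norm_add_le _ _
        _ ≤ N * C + C * N := add_le_add h1 h2
        _ = 2 * C * N := by ring
    have hpw : ∀ s ∈ Icc (0 : ℝ) 1, p s + w s ∈ Metric.ball x₀ ρ := by
      intro s hs
      have h1 := mem_ball_iff_norm.1 (hp s hs)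
      rw [mem_ball_iff_norm]
      calc ‖p s + w s - x₀‖ = ‖(p s - x₀) + w s‖ := by congr 1; abel
        _ ≤ ‖p s - x₀‖ + ‖w s‖ := norm_add_le _ _
        _ < ρ / 2 + ρ / 2 := add_lt_add h1 ((hw s hs).trans_lt hq3)
        _ = ρ := by ring
    have hg' : ∀ s ∈ Icc (0 : ℝ) 1, HasDerivAt (fun s => p s + w s)
        (t' • Y (p s) + t • fderiv ℝ Y (p s) (w s)) s := by
      intro s hs
      have d1 : HasDerivAt p (t • Y (p s)) s := hφs t ht x hx s hs
      have d2 : HasDerivAt (fun s => Y (p s)) (fderiv ℝ Y (p s) (t • Y (p s))) s :=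
        (hYd _ (hballρ (hp s hs))).hasFDerivAt.comp_hasDerivAt s d1
      have d3 : HasDerivAt (fun s : ℝ => s * τ) τ s := by
        simpa using (hasDerivAt_id s).mul_const τ
      have d4 := d3.smul d2
      have d5 : HasDerivAt (fun s => W x (s * t) h)
          ((t • (fderiv ℝ Y (φ (s * t, x))).comp (W x (s * t))) h) s := by
        simpa using (hWs s hs).clm_apply (hasDerivAt_const s h)
      refine (d1.add (d4.add d5)).congr_deriv ?_
      have : t' = t + τ := by rw [hτ]; ring
      simp only [w, p, this, map_add, map_smul, smul_apply,
        ContinuousLinearMap.comp_apply]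
      module
    have hgr := dist_le_of_approx_trajectories_ODE_of_mem (v := fun _ z => t' • Y z) (K := K)
      (s := fun _ => Metric.ball x₀ ρ) (a := 0) (b := 1) (δ := 0) (εf := 0) (εg := C' * N ^ 2)
      (f := fun s => φ (s * t', x')) (f' := fun s => t' • Y (φ (s * t', x')))
      (g := fun s => p s + w s) (g' := fun s => t' • Y (p s) + t • fderiv ℝ Y (p s) (w s))
      (fun _ _ => by
        refine LipschitzOnWith.of_dist_le_mul fun a ha b hb => ?_
        rw [dist_smul₀, Real.norm_eq_abs]
        exact (mul_le_of_le_one_left dist_nonneg ht'1).trans (hK.dist_le_mul a ha b hb))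
      (fun s hs => (hφs t' hq1 x' hq2 s hs).continuousAt.continuousWithinAt)
      (fun s hs => (hφs t' hq1 x' hq2 s (Ico_subset_Icc_self hs)).hasDerivWithinAt)
      (fun s hs => by simp)
      (fun s hs => hballρ (hball _ (hsc t' hq1 s (Ico_subset_Icc_self hs)) x' hq2))
      (fun s hs => (hg' s hs).continuousAt.continuousWithinAt)
      (fun s hs => (hg' s (Ico_subset_Icc_self hs)).hasDerivWithinAt)
      (fun s hs => by
        have hs := Ico_subset_Icc_self hs
        have hT := norm_image_sub_sub_fderiv_le (convex_ball x₀ ρ) hYd hM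
          (hballρ (hp s hs)) (hpw s hs)
        rw [add_sub_cancel_left] at hT
        have e : t' • Y (p s) + t • fderiv ℝ Y (p s) (w s) - t' • Y (p s + w s) =
            -(t' • (Y (p s + w s) - Y (p s) - fderiv ℝ Y (p s) (w s))) -
              τ • fderiv ℝ Y (p s) (w s) := by
          rw [show t = t' - τ by rw [hτ]; ring]; module
        rw [dist_eq_norm, e]
        have h1 : ‖t' • (Y (p s + w s) - Y (p s) - fderiv ℝ Y (p s) (w s))‖ ≤
            M * (2 * C * N) ^ 2 := by
          rw [norm_smul, Real.norm_eq_abs]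
          refine (mul_le_of_le_one_left (norm_nonneg _) ht'1).trans (hT.trans ?_)
          have := hw s hs
          gcongr
        have h2 : ‖τ • fderiv ℝ Y (p s) (w s)‖ ≤ N * (C * (2 * C * N)) := by
          rw [norm_smul, Real.norm_eq_abs]
          refine mul_le_mul hNτ ?_ (norm_nonneg _) hN0
          exact (ContinuousLinearMap.le_opNorm _ _).trans
            (mul_le_mul (hDC _ (hballρ (hp s hs))) (hw s hs) (norm_nonneg _) hC0)
        refine (norm_sub_le _ _).trans ?_
        rw [norm_neg]
        refine (add_le_add h1 h2).trans (le_of_eq ?_)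
        rw [hC']; ring)
      (fun s hs => hpw s (Ico_subset_Icc_self hs))
      (by simp [p, w, hφ0 x hx, hφ0 x' hq2, hW0 x hx, hh]) 1 ⟨zero_le_one, le_rfl⟩
    have hgb : gronwallBound 0 K (0 + C' * N ^ 2) (1 - 0) = gronwallBound 0 K C' 1 * N ^ 2 := by
      simp only [gronwallBound, sub_zero, zero_add, mul_one]
      split_ifs <;> ring
    rw [hgb, dist_eq_norm] at hgr
    refine le_trans (le_of_eq ?_) hgr
    congr 1
    simp only [p, w, one_mul, A, add_apply, ContinuousLinearMap.comp_apply,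
      ContinuousLinearMap.smulRight_apply, ContinuousLinearMap.coe_fst',
      ContinuousLinearMap.coe_snd', Prod.fst_sub, Prod.snd_sub]
    abel
  have hO : (fun q => φ q - φ (t, x) - A (q - (t, x))) =O[𝓝 ((t, x) : ℝ × E)]
      fun q => ‖q - (t, x)‖ ^ 2 :=
    Asymptotics.IsBigO.of_bound (gronwallBound 0 K C' 1) (key.mono fun q hq => by
      rwa [norm_pow, norm_norm])
  rw [hasFDerivAt_iff_isLittleO]
  have hA0 := hO.hasFDerivAt (𝕜 := ℝ) one_lt_two
  rw [hasFDerivAt_iff_isLittleO] at hA0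
  simpa using hA0

end Flow

/-! ### Existence of a smooth flow with known derivative. -/

section ExistsFlow

theorem eventually_prod_ball {E : Type*} [PseudoMetricSpace E] {p : ℝ × E → Prop} {x₀ : E} (h : ∀ᶠ q in 𝓝 ((0 : ℝ), x₀), p q) :
    ∃ ρ > 0, ∀ t ∈ Metric.ball (0 : ℝ) ρ, ∀ x ∈ Metric.ball x₀ ρ, p (t, x) := by
  obtain ⟨ρ, hρ, h⟩ := Metric.eventually_nhds_iff_ball.1 h
  refine ⟨ρ, hρ, fun t ht x hx => h _ ?_⟩
  rw [← ball_prod_same]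
  exact ⟨ht, hx⟩

variable {E F : Type*} [NormedAddCommGroup E] [NormedSpace ℝ E]
  [NormedAddCommGroup F] [NormedSpace ℝ F]

theorem ContDiffAt.exists_norm_le {G : Type*} [NormedAddCommGroup G] [NormedSpace ℝ G]
    {f : E → G} {x₀ : E} (hf : ContDiffAt ℝ ∞ f x₀) : ∃ C, ∀ᶠ x in 𝓝 x₀, ‖f x‖ ≤ C :=
  ⟨‖f x₀‖ + 1, (hf.continuousAt.norm.eventually_lt continuousAt_const (lt_add_one _)).mono
    fun _ h => h.le⟩

variable [CompleteSpace E]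

/-- A `C¹` vector field has a local flow which is jointly continuous. -/
theorem exists_continuousAt_flow {Y : E → E} {x₀ : E} (hY : ContDiffAt ℝ 1 Y x₀) :
    ∃ φ : ℝ × E → E, ContinuousAt φ (0, x₀) ∧ ∃ δ > 0, (∀ x ∈ Metric.ball x₀ δ, φ (0, x) = x) ∧
      ∀ t ∈ Metric.ball (0 : ℝ) δ, ∀ x ∈ Metric.ball x₀ δ,
        HasDerivAt (fun s => φ (s, x)) (Y (φ (t, x))) t := by
  obtain ⟨ε, hε, a, r, _, _, hr, hpl⟩ := IsPicardLindelof.of_contDiffAt_one hY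
  obtain ⟨α, hα, hα'⟩ := (hpl 0).exists_forall_mem_closedBall_eq_hasDerivWithinAt_continuousOn
  refine ⟨fun q => α (q.2, q.1), ?_, min ε r, lt_min hε hr, fun x hx => ?_, fun t ht x hx => ?_⟩
  · have h : ContinuousAt α (x₀, 0) := hα'.continuousAt
      (prod_mem_nhds (Metric.closedBall_mem_nhds _ hr) (Icc_mem_nhds (by simpa) (by simpa)))
    exact ContinuousAt.comp (f := fun q : ℝ × E => (q.2, q.1)) h (by fun_prop)
  · have hx' : x ∈ Metric.closedBall x₀ r :=
      Metric.ball_subset_closedBall (Metric.ball_subset_ball (min_le_right _ _) hx)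
    exact (hα x hx').1
  · have hx' : x ∈ Metric.closedBall x₀ r :=
      Metric.ball_subset_closedBall (Metric.ball_subset_ball (min_le_right _ _) hx)
    have ht' : |t| < ε := by
      have := Metric.ball_subset_ball (min_le_left ε r) ht
      simpa using this
    have h1 := abs_lt.1 ht'
    exact ((hα x hx').2 t ⟨by linarith, by linarith⟩).hasDerivAt
      (Icc_mem_nhds (by linarith) (by linarith))

/-- A smooth vector field for which solutions of the variational equation are known explicitly
(in the form `B`, with `S` a right inverse at time zero) has a smooth flow, whose derivative is given
by these solutions. -/
theorem exists_smooth_flow {Y : E → E} {x₀ : E} (hY : ∀ᶠ z in 𝓝 x₀, ContDiffAt ℝ ∞ Y z)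
    {B : ℝ × E → F →L[ℝ] E} {S : E → E →L[ℝ] F}
    (hB : ∀ᶠ q in 𝓝 ((0 : ℝ), x₀), ContDiffAt ℝ ∞ B q) (hS : ∀ᶠ x in 𝓝 x₀, ContDiffAt ℝ ∞ S x)
    (hBS : ∀ᶠ x in 𝓝 x₀, (B (0, x)).comp (S x) = ContinuousLinearMap.id ℝ E)
    (hBY : ∀ᶠ q in 𝓝 ((0 : ℝ), x₀),
      fderiv ℝ B q (1, Y q.2) = (fderiv ℝ Y q.2).comp (B q)) :
    ∃ φ : ℝ × E → E, (∀ᶠ x in 𝓝 x₀, φ (0, x) = x) ∧ ∀ᶠ q in 𝓝 ((0 : ℝ), x₀),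
      ContDiffAt ℝ ∞ φ q ∧ fderiv ℝ φ q (1, 0) = Y (φ q) ∧
        ∀ c : F, fderiv ℝ φ q (0, B (0, q.2) c) = B (q.1, φ q) c := by
  have hY0 := hY.self_of_nhds
  obtain ⟨φ, hφc, δ₀, hδ₀, hφ0, hφd⟩ := exists_continuousAt_flow (hY0.of_le (by exact_mod_cast le_top))
  have hY0' : ContDiffAt ℝ ∞ (fderiv ℝ Y) x₀ := hY0.fderiv_right (by norm_cast)
  obtain ⟨K, sK, hsK, hK⟩ := (hY0.of_le (m := 1) (by exact_mod_cast le_top)).exists_lipschitzOnWith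
  obtain ⟨M, sM, hsM, hM⟩ := (hY0'.of_le (m := 1) (by exact_mod_cast le_top)).exists_lipschitzOnWith
  obtain ⟨C₁, hC₁⟩ := hY0.exists_norm_le
  obtain ⟨C₂, hC₂⟩ := hY0'.exists_norm_le
  obtain ⟨C₃, hC₃⟩ := hS.self_of_nhds.exists_norm_le
  obtain ⟨C₄, hC₄⟩ := hB.self_of_nhds.exists_norm_le
  have hx : ∀ {p : E → Prop}, (∀ᶠ z in 𝓝 x₀, p z) → ∀ᶠ q in 𝓝 ((0 : ℝ), x₀), p q.2 := fun h =>
    (continuous_snd.tendsto ((0 : ℝ), x₀)).eventually h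
  obtain ⟨ρ, hρ, H⟩ := eventually_prod_ball ((hx hY).and <| (hx hsK).and <| (hx hsM).and <|
    (hx hC₁).and <| (hx hC₂).and <| (hx hC₃).and <| (hx hS).and <| (hx hBS).and <|
    hC₄.and <| hB.and hBY)
  have hz0 : (0 : ℝ) ∈ Metric.ball (0 : ℝ) ρ := Metric.mem_ball_self hρ
  have hφev : ∀ᶠ q in 𝓝 ((0 : ℝ), x₀), φ q ∈ Metric.ball x₀ (ρ / 2) := by
    refine hφc.eventually (Metric.isOpen_ball.mem_nhds ?_)
    rw [hφ0 x₀ (Metric.mem_ball_self hδ₀)]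
    exact Metric.mem_ball_self (by linarith)
  obtain ⟨δ₁, hδ₁, hδ₁'⟩ := eventually_prod_ball hφev
  set δ := min (min 1 ρ) (min δ₀ δ₁) with hδ
  have hδpos : 0 < δ := by positivity
  have hsub : Metric.ball x₀ δ ⊆ Metric.ball x₀ ρ ∧
      Metric.ball x₀ δ ⊆ Metric.ball x₀ δ₀ ∧ Metric.ball x₀ δ ⊆ Metric.ball x₀ δ₁ :=
    ⟨Metric.ball_subset_ball ((min_le_left _ _).trans (min_le_right _ _)),
      Metric.ball_subset_ball ((min_le_right _ _).trans (min_le_left _ _)),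
      Metric.ball_subset_ball ((min_le_right _ _).trans (min_le_right _ _))⟩
  have hsubR : Metric.ball (0 : ℝ) δ ⊆ Metric.ball 0 ρ ∧
      Metric.ball (0 : ℝ) δ ⊆ Metric.ball 0 δ₀ ∧ Metric.ball (0 : ℝ) δ ⊆ Metric.ball 0 δ₁ :=
    ⟨Metric.ball_subset_ball ((min_le_left _ _).trans (min_le_right _ _)),
      Metric.ball_subset_ball ((min_le_right _ _).trans (min_le_left _ _)),
      Metric.ball_subset_ball ((min_le_right _ _).trans (min_le_right _ _))⟩
  have hρ2 : Metric.ball x₀ (ρ / 2) ⊆ Metric.ball x₀ ρ := Metric.ball_subset_ball (by linarith)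
  have hmem : ∀ t ∈ Metric.ball (0 : ℝ) δ, ∀ x ∈ Metric.ball x₀ δ, φ (t, x) ∈ Metric.ball x₀ ρ :=
    fun t ht x hx => hρ2 (hδ₁' t (hsubR.2.2 ht) x (hsub.2.2 hx))
  have hBd : ∀ t ∈ Metric.ball (0 : ℝ) δ, ∀ x ∈ Metric.ball x₀ δ,
      HasDerivAt (fun s => B (s, φ (s, x)))
        ((fderiv ℝ Y (φ (t, x))).comp (B (t, φ (t, x)))) t := by
    intro t ht x hx
    obtain ⟨-, -, -, -, -, -, -, -, -, h1, h2⟩ := H t (hsubR.1 ht) _ (hmem t ht x hx)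
    have h3 : HasDerivAt (fun s => (s, φ (s, x))) (1, Y (φ (t, x))) t :=
      (hasDerivAt_id t).prodMk (hφd t (hsubR.2.1 ht) x (hsub.2.1 hx))
    have h4 := (h1.differentiableAt (by simp)).hasFDerivAt.comp_hasDerivAt t h3
    exact h4.congr_deriv h2
  -- The expected derivative of the flow in `x`: the known solution along the trajectory, normalised
  -- by `S` to be the identity at time zero.
  set W : E → ℝ → E →L[ℝ] E := fun x t => (B (t, φ (t, x))).comp (S x) with hWdef
  set C := max (max C₁ C₂) (C₄ * C₃) with hC
  have hW0 : ∀ x ∈ Metric.ball x₀ δ, W x 0 = ContinuousLinearMap.id ℝ E := by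
    intro x hx
    simp only [hWdef]
    rw [hφ0 x (hsub.2.1 hx)]
    exact (H 0 hz0 x (hsub.1 hx)).2.2.2.2.2.2.2.1
  have hWd : ∀ t ∈ Metric.ball (0 : ℝ) δ, ∀ x ∈ Metric.ball x₀ δ,
      HasDerivAt (W x) ((fderiv ℝ Y (φ (t, x))).comp (W x t)) t := by
    intro t ht x hx
    have := (hBd t ht x hx).clm_comp (hasDerivAt_const t (S x))
    refine this.congr_deriv ?_
    simp [hWdef, ContinuousLinearMap.comp_assoc]
  have hF : ∀ t ∈ Metric.ball (0 : ℝ) δ, ∀ x ∈ Metric.ball x₀ δ,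
      HasFDerivAt φ ((ContinuousLinearMap.fst ℝ ℝ E).smulRight (Y (φ (t, x))) +
        (W x t).comp (ContinuousLinearMap.snd ℝ ℝ E)) (t, x) := by
    intro t ht x hx
    refine hasFDerivAt_flow (C := C) (ρ := ρ) ((min_le_left _ _).trans (min_le_left _ _))
      (fun x hx => hφ0 x (hsub.2.1 hx))
      (fun t ht x hx => hφd t (hsubR.2.1 ht) x (hsub.2.1 hx))
      (fun t ht x hx => hδ₁' t (hsubR.2.2 ht) x (hsub.2.2 hx))
      (fun z hz => (H 0 hz0 z hz).1.differentiableAt (by simp))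
      (hK.mono fun z hz => (H 0 hz0 z hz).2.1) (hM.mono fun z hz => (H 0 hz0 z hz).2.2.1)
      (fun z hz => (H 0 hz0 z hz).2.2.2.1.trans ((le_max_left _ _).trans (le_max_left _ _)))
      (fun z hz => (H 0 hz0 z hz).2.2.2.2.1.trans ((le_max_right _ _).trans (le_max_left _ _)))
      hW0 hWd (fun t ht x hx => ?_) ht hx
    refine (ContinuousLinearMap.opNorm_comp_le _ _).trans (le_trans ?_ (le_max_right _ _))
    have h1 : ‖B (t, φ (t, x))‖ ≤ C₄ := (H t (hsubR.1 ht) _ (hmem t ht x hx)).2.2.2.2.2.2.2.2.1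
    exact mul_le_mul h1 (H 0 hz0 x (hsub.1 hx)).2.2.2.2.2.1 (norm_nonneg _)
      ((norm_nonneg _).trans h1)
  set Ω : Set (ℝ × E) := Metric.ball (0 : ℝ) δ ×ˢ Metric.ball x₀ δ with hΩ
  have hΩo : IsOpen Ω := Metric.isOpen_ball.prod Metric.isOpen_ball
  have hsmooth : ContDiffOn ℝ ∞ φ Ω := by
    refine contDiffOn_of_hasFDerivAt_comp hΩo (G := fun p : (ℝ × E) × E =>
      (ContinuousLinearMap.fst ℝ ℝ E).smulRight (Y p.2) +
        ((B (p.1.1, p.2)).comp (S p.1.2)).comp (ContinuousLinearMap.snd ℝ ℝ E))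
      (fun q hq => ?_) (fun q hq => hF q.1 hq.1 q.2 hq.2)
    have hm := hmem q.1 hq.1 q.2 hq.2
    have h1 := H q.1 (hsubR.1 hq.1) _ hm
    have h2 := H 0 hz0 q.2 (hsub.1 hq.2)
    have c1 : ContDiffAt ℝ ∞ (fun p : (ℝ × E) × E => Y p.2) (q, φ q) :=
      ContDiffAt.comp (q, φ q) (h1.1 : ContDiffAt ℝ ∞ Y (φ q)) contDiffAt_snd
    have c2 : ContDiffAt ℝ ∞ (fun p : (ℝ × E) × E => B (p.1.1, p.2)) (q, φ q) :=
      ContDiffAt.comp (f := fun p : (ℝ × E) × E => (p.1.1, p.2)) (q, φ q)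
        (h1.2.2.2.2.2.2.2.2.2.1 : ContDiffAt ℝ ∞ B (q.1, φ q)) (by fun_prop)
    have c3 : ContDiffAt ℝ ∞ (fun p : (ℝ × E) × E => S p.1.2) (q, φ q) :=
      ContDiffAt.comp (f := fun p : (ℝ × E) × E => p.1.2) (q, φ q)
        (h2.2.2.2.2.2.2.1 : ContDiffAt ℝ ∞ S q.2) (by fun_prop)
    have c4 : ContDiffAt ℝ ∞ (fun p : (ℝ × E) × E =>
        (ContinuousLinearMap.fst ℝ ℝ E).smulRight (Y p.2)) (q, φ q) :=
      (ContinuousLinearMap.smulRightL ℝ (ℝ × E) E (ContinuousLinearMap.fst ℝ ℝ E)).contDiff.contDiffAt.comp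
        (q, φ q) c1
    exact c4.add ((c2.clm_comp c3).clm_comp contDiffAt_const)
  refine ⟨φ, Metric.eventually_nhds_iff_ball.2 ⟨δ₀, hδ₀, hφ0⟩, ?_⟩
  filter_upwards [hΩo.mem_nhds ⟨Metric.mem_ball_self hδpos, Metric.mem_ball_self hδpos⟩] with q hq
  obtain ⟨t, x⟩ := q
  have ht : t ∈ Metric.ball (0 : ℝ) δ := hq.1
  have hxm : x ∈ Metric.ball x₀ δ := hq.2
  refine ⟨hsmooth.contDiffAt (hΩo.mem_nhds hq), by simp [(hF t ht x hxm).fderiv], fun c => ?_⟩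
  have hlin : fderiv ℝ φ (t, x) (0, B (0, x) c) = W x t (B (0, x) c) := by
    simp [(hF t ht x hxm).fderiv]
  rw [show ((t, x) : ℝ × E).2 = x from rfl, hlin, eq_comm, ← sub_eq_zero]
  have hsc : ∀ s ∈ Icc (0 : ℝ) 1, s * t ∈ Metric.ball (0 : ℝ) δ := by
    intro s hs
    rw [mem_ball_zero_iff, Real.norm_eq_abs] at ht ⊢
    rw [abs_mul, abs_of_nonneg hs.1]
    exact (mul_le_of_le_one_left (abs_nonneg _) hs.2).trans_lt ht
  -- Both terms solve the same linear variational equation with the same initial value `B (0, x) c`,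
  -- so their difference vanishes by uniqueness.
  let D : ℝ → E := fun s => B (s * t, φ (s * t, x)) c - W x (s * t) (B (0, x) c)
  have hD : ∀ s ∈ Icc (0 : ℝ) 1, HasDerivAt D (t • fderiv ℝ Y (φ (s * t, x)) (D s)) s := by
    intro s hs
    have h1 : HasDerivAt (fun s : ℝ => s * t) t s := by simpa using (hasDerivAt_id s).mul_const t
    have h2 := HasDerivAt.scomp s (hBd _ (hsc s hs) x hxm) h1
    have h3 := HasDerivAt.scomp s (hWd _ (hsc s hs) x hxm) h1
    refine ((h2.clm_apply (hasDerivAt_const s c)).sub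
      (h3.clm_apply (hasDerivAt_const s (B (0, x) c)))).congr_deriv ?_
    simp [D, smul_sub]
  have hDz := eq_zero_of_abs_deriv_le_mul_abs_self_of_eq_zero_right (K := |t| * C) (a := 0) (b := 1)
    (fun s hs => (hD s hs).continuousAt.continuousWithinAt)
    (fun s hs => (hD s (Ico_subset_Icc_self hs)).hasDerivWithinAt)
    (by
      have h1 := hW0 x hxm
      have h2 := hφ0 x (hsub.2.1 hxm)
      simp [D, h1, h2])
    (fun s hs => by
      rw [norm_smul, Real.norm_eq_abs, mul_assoc]
      gcongr
      refine (ContinuousLinearMap.le_opNorm _ _).trans ?_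
      gcongr
      exact (H 0 hz0 _ (hmem _ (hsc s (Ico_subset_Icc_self hs)) x hxm)).2.2.2.2.1.trans
        ((le_max_right _ _).trans (le_max_left _ _))) 1 ⟨zero_le_one, le_rfl⟩
  simpa [D] using hDz

end ExistsFlow

/-! ### Exponentials and invariant subspaces. -/

section Exponential

variable {F : Type*} [NormedAddCommGroup F] [NormedSpace ℝ F] [FiniteDimensional ℝ F]

/-- If `A` preserves a subspace `S` and `A v ∈ S`, then `exp A v = v` modulo `S`. -/
theorem exp_apply_sub_mem (A : F →L[ℝ] F) (S : Submodule ℝ F) (hS : ∀ w ∈ S, A w ∈ S) {v : F}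
    (hv : A v ∈ S) : NormedSpace.exp A v - v ∈ S := by
  have : CompleteSpace F := FiniteDimensional.complete ℝ F
  have hpow : ∀ j, (A ^ (j + 1)) v ∈ S := by
    intro j
    induction j with
    | zero => simpa using hv
    | succ j ih => rw [pow_succ', mul_apply_eq_comp]; exact hS _ ih
  have h0 : HasSum (fun j : ℕ => ((j.factorial : ℝ)⁻¹ • A ^ j)) (NormedSpace.exp A) :=
    NormedSpace.exp_series_hasSum_exp' A
  have h1 : HasSum (fun j : ℕ => (j.factorial : ℝ)⁻¹ • (A ^ j) v) (NormedSpace.exp A v) :=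
    h0.mapL (ContinuousLinearMap.apply ℝ F v)
  have h2 : HasSum (fun j : ℕ => ((j + 1).factorial : ℝ)⁻¹ • (A ^ (j + 1)) v)
      (NormedSpace.exp A v - v) := by
    have := (hasSum_nat_add_iff' 1).2 h1
    rwa [Finset.sum_range_one, Nat.factorial_zero, Nat.cast_one, inv_one, one_smul, pow_zero,
      one_apply_eq_self] at this
  have h3 : NormedSpace.exp A v - v ∈ closure (S : Set F) := by
    refine mem_closure_of_tendsto h2.tendsto_sum_nat (Filter.Eventually.of_forall fun s => ?_)
    exact S.sum_mem fun j _ => S.smul_mem _ (hpow j)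
  rwa [S.closed_of_finiteDimensional.closure_eq] at h3

theorem exp_apply_exp_neg_apply (A : F →L[ℝ] F) (v : F) :
    NormedSpace.exp A (NormedSpace.exp (-A) v) = v := by
  have : CompleteSpace F := FiniteDimensional.complete ℝ F
  let _ : NormedAlgebra ℚ (F →L[ℝ] F) := NormedAlgebra.restrictScalars ℚ ℝ _
  have h := NormedSpace.exp_add_of_commute (Commute.neg_right (Commute.refl A))
  rw [add_neg_cancel, NormedSpace.exp_zero] at h
  exact (congrArg (fun f : F →L[ℝ] F => f v) h).symm

end Exponential

/-! ### Flows of elements of `L`. -/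

namespace LocalVF

variable {n : ℕ} {U : Opens (Fin n → ℝ)}

/-- The evaluation of the elements of `L` at a point, in terms of coordinates on `L`. -/
noncomputable def evalCLM (L : LieSubalgebra ℝ (SmoothVF U)) [FiniteDimensional ℝ L]
    (z : Fin n → ℝ) : (Fin (Module.finrank ℝ L) → ℝ) →L[ℝ] (Fin n → ℝ) :=
  LinearMap.toContinuousLinearMap ((SmoothVF.evalAt z).comp
    (L.toSubmodule.subtype.comp (Module.finBasis ℝ L).equivFun.symm.toLinearMap))

/-- The adjoint action of an element of `L`, in terms of coordinates on `L`. -/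
noncomputable def adCLM (L : LieSubalgebra ℝ (SmoothVF U)) [FiniteDimensional ℝ L] (Y : L) :
    (Fin (Module.finrank ℝ L) → ℝ) →L[ℝ] (Fin (Module.finrank ℝ L) → ℝ) :=
  LinearMap.toContinuousLinearMap ((Module.finBasis ℝ L).equivFun.toLinearMap.comp
    ((LieAlgebra.ad ℝ L Y).comp (Module.finBasis ℝ L).equivFun.symm.toLinearMap))

variable {L : LieSubalgebra ℝ (SmoothVF U)} [FiniteDimensional ℝ L]

theorem evalCLM_apply (z : Fin n → ℝ) (c : Fin (Module.finrank ℝ L) → ℝ) :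
    evalCLM L z c = ((Module.finBasis ℝ L).equivFun.symm c).1 z := rfl

theorem evalCLM_equivFun (z : Fin n → ℝ) (X : L) :
    evalCLM L z ((Module.finBasis ℝ L).equivFun X) = X.1 z := by
  rw [evalCLM_apply, LinearEquiv.symm_apply_apply]

theorem adCLM_apply (Y : L) (c : Fin (Module.finrank ℝ L) → ℝ) :
    adCLM L Y c =
      (Module.finBasis ℝ L).equivFun ⁅Y, (Module.finBasis ℝ L).equivFun.symm c⁆ := rfl

theorem contDiffAt_evalCLM {z : Fin n → ℝ} (hz : z ∈ U) : ContDiffAt ℝ ∞ (evalCLM L) z := by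
  have : ContDiffOn ℝ ∞ (evalCLM L) U := contDiffOn_clm_apply.2 fun c =>
    ((Module.finBasis ℝ L).equivFun.symm c).1.2.1
  exact this.contDiffAt (U.isOpen.mem_nhds hz)

/-- This is the formula `[Y, X] = DX(Y) - DY(X)`, read for all `X ∈ L` at once. -/
theorem fderiv_evalCLM {z : Fin n → ℝ} (hz : z ∈ U) (Y : L) :
    fderiv ℝ (evalCLM L) z (Y.1 z) =
      (evalCLM L z).comp (adCLM L Y) + (fderiv ℝ Y.1 z).comp (evalCLM L z) := by
  refine ContinuousLinearMap.ext fun c => ?_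
  have hd := ((contDiffAt_evalCLM (L := L) hz).differentiableAt (by simp)).hasFDerivAt
  have h1 := (hd.clm_apply (hasFDerivAt_const c z)).fderiv
  have h2 : fderiv ℝ (fun z => evalCLM L z c) z (Y.1 z) = fderiv ℝ (evalCLM L) z (Y.1 z) c := by
    rw [h1]; simp
  rw [← h2, add_apply, ContinuousLinearMap.comp_apply, ContinuousLinearMap.comp_apply,
    adCLM_apply, evalCLM_equivFun, LieSubalgebra.coe_bracket, SmoothVF.bracket_apply _ _ hz,
    VectorField.lieBracket_eq]
  simp only [evalCLM_apply]
  exact (sub_add_cancel _ _).symm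

/-- The local flow of `Y ∈ L` is smooth; its derivative maps the value of `X ∈ L` to the value of
`exp (-t ad Y) X ∈ L`. -/
theorem exists_flow (hL : IsTransitive L) {x₀ : Fin n → ℝ} (hx₀ : x₀ ∈ U) (Y : L) :
    ∃ φ : ℝ × (Fin n → ℝ) → (Fin n → ℝ), (∀ᶠ x in 𝓝 x₀, φ (0, x) = x) ∧
      ∀ᶠ q in 𝓝 ((0 : ℝ), x₀), ContDiffAt ℝ ∞ φ q ∧ fderiv ℝ φ q (1, 0) = Y.1 (φ q) ∧
        (∀ X : L, ∃ X' : L, fderiv ℝ φ q (0, X.1 q.2) = X'.1 (φ q) ∧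
          ∀ J : LieIdeal ℝ L, ⁅Y, X⁆ ∈ J → X' - X ∈ J) ∧
        ∀ X' : L, ∃ X : L, fderiv ℝ φ q (0, X.1 q.2) = X'.1 (φ q) ∧
          ∀ J : LieIdeal ℝ L, X' ∈ J → X ∈ J := by
  set e := (Module.finBasis ℝ L).equivFun with he
  set A := adCLM L Y with hA
  -- The explicit solution of the variational equation: evaluation at `x` after `exp (-t ad Y)`.
  let B : ℝ × (Fin n → ℝ) → (Fin (Module.finrank ℝ L) → ℝ) →L[ℝ] (Fin n → ℝ) :=
    fun q => (evalCLM L q.2).comp (NormedSpace.exp (q.1 • (-A)))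
  have hUx : ∀ᶠ x in 𝓝 x₀, x ∈ U := U.isOpen.mem_nhds hx₀
  have hUq : ∀ᶠ q in 𝓝 ((0 : ℝ), x₀), q.2 ∈ U := (continuous_snd.tendsto ((0 : ℝ), x₀)).eventually hUx
  have hBc : ∀ q : ℝ × (Fin n → ℝ), q.2 ∈ U → ContDiffAt ℝ ∞ B q := by
    intro q hq
    refine ContDiffAt.clm_comp ((contDiffAt_evalCLM hq).comp q contDiffAt_snd) ?_
    exact (NormedSpace.exp_analytic (𝕂 := ℝ) (q.1 • (-A))).contDiffAt.comp
      (f := fun q : ℝ × (Fin n → ℝ) => q.1 • (-A)) q (by fun_prop)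
  have hsurj : Function.Surjective (evalCLM L x₀) := by
    intro v
    have hv : v ∈ L.toSubmodule.map (SmoothVF.evalAt x₀) := by rw [hL x₀ hx₀]; trivial
    obtain ⟨X, hX, rfl⟩ := hv
    exact ⟨e ⟨X, hX⟩, evalCLM_equivFun x₀ ⟨X, hX⟩⟩
  obtain ⟨σ₀, hσ₀⟩ := (evalCLM L x₀).toLinearMap.exists_rightInverse_of_surjective
    (LinearMap.range_eq_top.2 hsurj)
  let σ : (Fin n → ℝ) →L[ℝ] (Fin (Module.finrank ℝ L) → ℝ) := LinearMap.toContinuousLinearMap σ₀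
  -- A right inverse `σ` of the evaluation at `x₀` is corrected to one at nearby `x`: `T x` is the
  -- identity at `x₀`, hence invertible near it, and `σ ∘ (T x)⁻¹` depends smoothly on `x`.
  let T : (Fin n → ℝ) → (Fin n → ℝ) →L[ℝ] (Fin n → ℝ) := fun x => (evalCLM L x).comp σ
  have hTc : ∀ x ∈ U, ContDiffAt ℝ ∞ T x := fun x hx =>
    (contDiffAt_evalCLM hx).clm_comp contDiffAt_const
  have hT0 : T x₀ = (ContinuousLinearEquiv.refl ℝ (Fin n → ℝ) : (Fin n → ℝ) →L[ℝ] (Fin n → ℝ)) :=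
    ContinuousLinearMap.ext fun v => LinearMap.congr_fun hσ₀ v
  have hTinv : ∀ᶠ x in 𝓝 x₀, (T x).IsInvertible := by
    have := (hTc x₀ hx₀).continuousAt
    refine this.eventually (p := fun f => f.IsInvertible) ?_
    rw [hT0]
    exact ContinuousLinearEquiv.nhds _
  let S : (Fin n → ℝ) → (Fin n → ℝ) →L[ℝ] (Fin (Module.finrank ℝ L) → ℝ) :=
    fun x => σ.comp (T x).inverse
  obtain ⟨φ, hφ0, hφ⟩ := exists_smooth_flow (Y := Y.1) (x₀ := x₀) (B := B) (S := S)
    (hUx.mono fun z hz => Y.1.contDiffAt hz) (hUq.mono hBc)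
    (by
      filter_upwards [hUx, hTinv] with x hx hTx
      exact contDiffAt_const.clm_comp (hTx.contDiffAt_map_inverse.comp x (hTc x hx)))
    (by
      filter_upwards [hTinv] with x hTx
      have : (B (0, x)).comp (S x) = (T x).comp (T x).inverse := by
        simp [B, S, T, ContinuousLinearMap.comp_assoc, NormedSpace.exp_zero,
          ContinuousLinearMap.one_def]
      rw [this]
      exact hTx.self_comp_inverse)
    (by
      filter_upwards [hUq] with q hq
      have h1 : HasDerivAt (fun s : ℝ => (q.1 + s, q.2 + s • Y.1 q.2)) (1, Y.1 q.2) 0 := by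
        have a1 := (hasDerivAt_id (0 : ℝ)).const_add q.1
        have a2 := ((hasDerivAt_id (0 : ℝ)).smul_const (Y.1 q.2)).const_add q.2
        simpa using a1.prodMk a2
      have hq0 : (q.1 + (0 : ℝ), q.2 + (0 : ℝ) • Y.1 q.2) = q := by simp
      have h2 : HasDerivAt (fun s : ℝ => B (q.1 + s, q.2 + s • Y.1 q.2))
          (fderiv ℝ B q (1, Y.1 q.2)) 0 := by
        have hB : HasFDerivAt B (fderiv ℝ B q) (q.1 + (0 : ℝ), q.2 + (0 : ℝ) • Y.1 q.2) := by
          rw [hq0]; exact ((hBc q hq).differentiableAt (by simp)).hasFDerivAt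
        exact hB.comp_hasDerivAt (0 : ℝ) h1
      have h3 : HasDerivAt (fun s : ℝ => evalCLM L (q.2 + s • Y.1 q.2))
          (fderiv ℝ (evalCLM L) q.2 (Y.1 q.2)) 0 := by
        have hB : HasFDerivAt (evalCLM L) (fderiv ℝ (evalCLM L) q.2)
            (q.2 + (0 : ℝ) • Y.1 q.2) := by
          rw [zero_smul, add_zero]
          exact ((contDiffAt_evalCLM hq).differentiableAt (by simp)).hasFDerivAt
        have a2 : HasDerivAt (fun s : ℝ => q.2 + s • Y.1 q.2) (Y.1 q.2) 0 := by
          simpa using ((hasDerivAt_id (0 : ℝ)).smul_const (Y.1 q.2)).const_add q.2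
        exact hB.comp_hasDerivAt (0 : ℝ) a2
      have h4 : HasDerivAt (fun s : ℝ => NormedSpace.exp ((q.1 + s) • (-A)))
          ((-A) * NormedSpace.exp (q.1 • (-A))) 0 := by
        have a3 : HasDerivAt (fun u : ℝ => NormedSpace.exp (u • (-A)))
            ((-A) * NormedSpace.exp ((q.1 + 0) • (-A))) (q.1 + 0) :=
          hasDerivAt_exp_smul_const' (-A) (q.1 + 0)
        simpa using a3.comp_const_add q.1 0
      -- The `ad Y` term from differentiating the evaluation cancels the one from the exponential,
      -- which commutes with nothing here but need not: both stand to its left.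
      have h5 := h2.unique (h3.clm_comp h4)
      rw [h5, fderiv_evalCLM hq]
      refine ContinuousLinearMap.ext fun c => ?_
      simp [B, hA, ContinuousLinearMap.mul_def])
  have hB0 : ∀ x c, B (0, x) c = evalCLM L x c := by
    intro x c
    simp [B, NormedSpace.exp_zero]
  refine ⟨φ, hφ0, ?_⟩
  filter_upwards [hφ] with q hq
  refine ⟨hq.1, hq.2.1, fun X => ?_, fun X' => ?_⟩
  · refine ⟨e.symm (NormedSpace.exp (q.1 • (-A)) (e X)), ?_, fun J hJ => ?_⟩
    · have := hq.2.2 (e X)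
      rw [hB0, evalCLM_equivFun] at this
      exact this
    · have := exp_apply_sub_mem (q.1 • (-A)) (J.toSubmodule.map e.toLinearMap)
        (v := e X) (fun w hw => ?_) ?_
      · obtain ⟨Z, hZ, hZ'⟩ := this
        have hZ'' : e Z = NormedSpace.exp (q.1 • (-A)) (e X) - e X := hZ'
        have : e.symm (NormedSpace.exp (q.1 • (-A)) (e X)) - X = Z := by
          rw [← e.symm_apply_apply Z, hZ'', map_sub, e.symm_apply_apply]
        rw [this]
        exact hZ
      · obtain ⟨Z, hZ, rfl⟩ := hw
        refine ⟨-(q.1 • ⁅Y, Z⁆), J.neg_mem (J.smul_mem _ (lie_mem_right ℝ L J Y Z hZ)), ?_⟩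
        simp [hA, adCLM_apply, ← he]
      · refine ⟨-(q.1 • ⁅Y, X⁆), J.neg_mem (J.smul_mem _ hJ), ?_⟩
        simp [hA, adCLM_apply, ← he]
  · refine ⟨e.symm (NormedSpace.exp (-(q.1 • (-A))) (e X')), ?_, fun J hJ => ?_⟩
    · have := hq.2.2 (NormedSpace.exp (-(q.1 • (-A))) (e X'))
      rw [hB0, evalCLM_apply] at this
      rw [this]
      change evalCLM L (φ q) (NormedSpace.exp (q.1 • (-A)) (NormedSpace.exp (-(q.1 • (-A)))
        (e X'))) = _
      rw [exp_apply_exp_neg_apply, evalCLM_equivFun]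
    · have hstable : ∀ w ∈ J.toSubmodule.map e.toLinearMap,
          (-(q.1 • (-A))) w ∈ J.toSubmodule.map e.toLinearMap := by
        rintro _ ⟨Z, hZ, rfl⟩
        refine ⟨q.1 • ⁅Y, Z⁆, J.smul_mem _ (lie_mem_right ℝ L J Y Z hZ), ?_⟩
        simp [hA, adCLM_apply, ← he]
      have hX' : e X' ∈ J.toSubmodule.map e.toLinearMap := ⟨X', hJ, rfl⟩
      have h1 := exp_apply_sub_mem _ _ hstable (hstable _ hX')
      have h2 := Submodule.add_mem _ h1 hX'
      rw [sub_add_cancel] at h2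
      obtain ⟨Z, hZ, hZ'⟩ := h2
      have hZ'' : e Z = NormedSpace.exp (-(q.1 • (-A))) (e X') := hZ'
      rw [← hZ'', e.symm_apply_apply]
      exact hZ

end LocalVF

/-! ### Compositions of flows and the rank of an ideal. -/

namespace LocalVF

variable {n : ℕ} {U : Opens (Fin n → ℝ)}

theorem distributionOf_mono {L : LieSubalgebra ℝ (SmoothVF U)} {I J : LieIdeal ℝ L} (h : I ≤ J)
    (x : Fin n → ℝ) : distributionOf I x ≤ distributionOf J x :=
  Submodule.map_mono h

variable {L : LieSubalgebra ℝ (SmoothVF U)} [FiniteDimensional ℝ L]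

/-- The composition of the flows of `Y₀, …, Y_{k-1}` (the flow of `Y₀` being applied first), as a
function of the times. -/
theorem exists_comp_flows (hL : IsTransitive L) {x₀ : Fin n → ℝ} (hx₀ : x₀ ∈ U) (Y : Fin n → L)
    (J : Fin n → LieIdeal ℝ L) (hJ : ∀ i l, i < l → ⁅Y l, Y i⁆ ∈ J i) (k : ℕ) (hk : k ≤ n) :
    ∃ Ψ : (Fin n → ℝ) → (Fin n → ℝ), Ψ 0 = x₀ ∧
      (∀ i : Fin n, (i : ℕ) < k → fderiv ℝ Ψ 0 (Pi.single i 1) = (Y i).1 x₀) ∧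
      ∀ᶠ t in 𝓝 (0 : Fin n → ℝ), ContDiffAt ℝ ∞ Ψ t ∧
        (∀ i : Fin n, (i : ℕ) < k →
          ∃ Z : L, Z - Y i ∈ J i ∧ fderiv ℝ Ψ t (Pi.single i 1) = Z.1 (Ψ t)) ∧
        (∀ i : Fin n, k ≤ (i : ℕ) → fderiv ℝ Ψ t (Pi.single i 1) = 0) ∧
        ∀ I : LieIdeal ℝ L, Module.finrank ℝ (distributionOf I (Ψ t)) ≤
          Module.finrank ℝ (distributionOf I x₀) := by
  induction k with
  | zero =>
    refine ⟨fun _ => x₀, rfl, fun i hi => absurd hi (Nat.not_lt_zero _), Filter.Eventually.of_forall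
      fun t => ⟨contDiffAt_const, fun i hi => absurd hi (Nat.not_lt_zero _), fun i _ => ?_,
        fun I => le_rfl⟩⟩
    simp
  | succ k ih =>
    obtain ⟨Ψ, hΨ0, hΨd, hΨ⟩ := ih (by omega)
    set κ : Fin n := ⟨k, by omega⟩ with hκ
    obtain ⟨φ, hφ0, hφ⟩ := exists_flow hL hx₀ (Y κ)
    -- The new flow is applied last. It transports the earlier parameter derivatives, while the
    -- derivative in the new parameter is exactly `Y κ`.
    let p : (Fin n → ℝ) → ℝ × (Fin n → ℝ) := fun t => (t κ, Ψ t)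
    have hp0 : p 0 = (0, x₀) := by simp [p, hΨ0]
    have hpd : ∀ t, ContDiffAt ℝ ∞ Ψ t → HasFDerivAt p
        ((ContinuousLinearMap.proj (R := ℝ) (φ := fun _ : Fin n => ℝ) κ).prod (fderiv ℝ Ψ t)) t :=
      fun t ht => HasFDerivAt.prodMk (hasFDerivAt_apply κ t)
        (ht.differentiableAt (by simp)).hasFDerivAt
    have hpc : ContinuousAt p 0 := (hpd 0 hΨ.self_of_nhds.1).continuousAt
    have hφp : ∀ᶠ t in 𝓝 (0 : Fin n → ℝ), _ := hpc.eventually (hp0.symm ▸ hφ)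
    have hder : ∀ t, ContDiffAt ℝ ∞ Ψ t → ContDiffAt ℝ ∞ φ (p t) → ∀ v,
        fderiv ℝ (fun t => φ (p t)) t v = fderiv ℝ φ (p t) (v κ, fderiv ℝ Ψ t v) := by
      intro t h1 h2 v
      have := ((h2.differentiableAt (by simp)).hasFDerivAt.comp t (hpd t h1)).fderiv
      exact congrArg (fun f => f v) this
    have hinr : ∀ v, fderiv ℝ φ (0, x₀) (0, v) = v := by
      intro v
      have h1 := (hφ.self_of_nhds.1.differentiableAt (by simp)).hasFDerivAt
      have h2 : HasFDerivAt (fun x => φ (0, x))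
          ((fderiv ℝ φ (0, x₀)).comp (ContinuousLinearMap.inr ℝ ℝ (Fin n → ℝ))) x₀ :=
        HasFDerivAt.comp (f := fun x => ((0 : ℝ), x)) x₀ h1 (hasFDerivAt_prodMk_right 0 x₀)
      have h3 : HasFDerivAt (fun x => φ (0, x)) (ContinuousLinearMap.id ℝ (Fin n → ℝ)) x₀ :=
        (hasFDerivAt_id x₀).congr_of_eventuallyEq hφ0
      exact congrArg (fun f => f v) (h2.unique h3)
    have hφx₀ : φ (0, x₀) = x₀ := hφ0.self_of_nhds
    refine ⟨fun t => φ (p t), (congrArg φ hp0).trans hφx₀, fun i hi => ?_, ?_⟩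
    · rw [hder 0 hΨ.self_of_nhds.1 hφp.self_of_nhds.1, hp0]
      rcases Nat.lt_succ_iff_lt_or_eq.1 hi with hi | hi
      · have hne : κ ≠ i := by rintro rfl; exact lt_irrefl _ hi
        rw [hΨd i hi, Pi.single_eq_of_ne hne, hinr]
      · obtain rfl : i = κ := Fin.ext hi
        rw [Pi.single_eq_same, hΨ.self_of_nhds.2.2.1 κ hi.ge, hφ.self_of_nhds.2.1, hφx₀]
    · filter_upwards [hΨ, hφp] with t h1 h2
      refine ⟨h2.1.comp t ((contDiffAt_apply ℝ ℝ κ t).prodMk h1.1), fun i hi => ?_,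
        fun i hi => ?_, fun I => ?_⟩
      · rcases Nat.lt_succ_iff_lt_or_eq.1 hi with hi | hi
        · have hne : κ ≠ i := by rintro rfl; exact lt_irrefl _ hi
          obtain ⟨Z, hZ, hZd⟩ := h1.2.1 i hi
          obtain ⟨Z', hZ', hZJ⟩ := h2.2.2.1 Z
          refine ⟨Z', ?_, ?_⟩
          · have hb : ⁅Y κ, Z⁆ ∈ J i := by
              have e : ⁅Y κ, Z⁆ = ⁅Y κ, Z - Y i⁆ + ⁅Y κ, Y i⁆ := by rw [lie_sub, sub_add_cancel]
              rw [e]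
              exact add_mem (lie_mem_right ℝ L (J i) _ _ hZ) (hJ i κ hi)
            have := add_mem (hZJ (J i) hb) hZ
            rwa [sub_add_sub_cancel] at this
          · rw [hder t h1.1 h2.1, hZd, Pi.single_eq_of_ne hne]
            exact hZ'
        · obtain rfl : i = κ := Fin.ext hi
          refine ⟨Y κ, by rw [sub_self]; exact zero_mem _, ?_⟩
          rw [hder t h1.1 h2.1, h1.2.2.1 κ hi.ge, Pi.single_eq_same, h2.2.1]
      · have hne : κ ≠ i := by rintro rfl; exact absurd hi (by simp [hκ])
        rw [hder t h1.1 h2.1, h1.2.2.1 i (by omega), Pi.single_eq_of_ne hne]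
        exact map_zero _
      · refine le_trans ?_ (h1.2.2.2 I)
        -- Every value of `I` at the end of the flow is the image of a value of `I` at its start, so
        -- the rank cannot increase.
        have hle : distributionOf I (φ (p t)) ≤ (distributionOf I (Ψ t)).map
            ((fderiv ℝ φ (p t)).comp (ContinuousLinearMap.inr ℝ ℝ (Fin n → ℝ))).toLinearMap := by
          rintro _ ⟨X', hX', rfl⟩
          obtain ⟨X, hX, hXI⟩ := h2.2.2.2 X'
          exact ⟨X.1 (Ψ t), ⟨X, hXI I hX', rfl⟩, hX⟩
        exact (Submodule.finrank_mono hle).trans (Submodule.finrank_map_le _ _)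

/-- The composition of the flows of a frame of elements of `L` is a local diffeomorphism. -/
theorem exists_flow_chart (hL : IsTransitive L) {x₀ : Fin n → ℝ} (hx₀ : x₀ ∈ U) (Y : Fin n → L)
    (hY : LinearIndependent ℝ fun i => (Y i).1 x₀) (J : Fin n → LieIdeal ℝ L)
    (hJ : ∀ i l, i < l → ⁅Y l, Y i⁆ ∈ J i) :
    ∃ Ψ : (Fin n → ℝ) → (Fin n → ℝ), Ψ 0 = x₀ ∧ (fderiv ℝ Ψ 0).IsInvertible ∧
      ∀ᶠ t in 𝓝 (0 : Fin n → ℝ), ContDiffAt ℝ ∞ Ψ t ∧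
        (∀ i : Fin n, ∃ Z : L, Z - Y i ∈ J i ∧ fderiv ℝ Ψ t (Pi.single i 1) = Z.1 (Ψ t)) ∧
        ∀ I : LieIdeal ℝ L, Module.finrank ℝ (distributionOf I (Ψ t)) ≤
          Module.finrank ℝ (distributionOf I x₀) := by
  obtain ⟨Ψ, h0, hd, hΨ⟩ := exists_comp_flows hL hx₀ Y J hJ n le_rfl
  refine ⟨Ψ, h0, ?_, hΨ.mono fun t ht => ⟨ht.1, fun i => ht.2.1 i i.2, ht.2.2.2⟩⟩
  have hinj : Function.Injective (fderiv ℝ Ψ 0) := by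
    rw [injective_iff_map_eq_zero]
    intro v hv
    have e : v = ∑ i, v i • (Pi.single i 1 : Fin n → ℝ) := by
      simpa using (pi_eq_sum_univ' v)
    rw [e, map_sum] at hv
    simp only [map_smul, hd _ (Fin.is_lt _)] at hv
    exact funext (Fintype.linearIndependent_iff.1 hY v hv)
  exact ⟨(LinearEquiv.ofInjectiveEndo (fderiv ℝ Ψ 0).toLinearMap hinj).toContinuousLinearEquiv,
    ContinuousLinearMap.ext fun v => rfl⟩

/-- If the values of an ideal of a transitive Lie algebra vanish at one point of a connected open
set, then the ideal vanishes. -/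
theorem eq_bot_of_finrank_distributionOf_eq_zero (hU : IsConnected (U : Set (Fin n → ℝ)))
    (hL : IsTransitive L) (I : LieIdeal ℝ L) {x₀ : Fin n → ℝ} (hx₀ : x₀ ∈ U)
    (h : Module.finrank ℝ (distributionOf I x₀) = 0) : I = ⊥ := by
  have hopen : ∀ x ∈ U, Module.finrank ℝ (distributionOf I x) = 0 →
      ∀ᶠ z in 𝓝 x, Module.finrank ℝ (distributionOf I z) = 0 := by
    intro x hx hI
    have hsurj : ∀ v : Fin n → ℝ, ∃ X : L, X.1 x = v := by
      intro v
      have hv : v ∈ L.toSubmodule.map (SmoothVF.evalAt x) := by rw [hL x hx]; trivial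
      obtain ⟨X, hX, rfl⟩ := hv
      exact ⟨⟨X, hX⟩, rfl⟩
    choose s hs using hsurj
    -- All points near `x` are reached from `x` by flows, which do not increase the rank. Only this
    -- is needed, so the ideals `J` are taken to be `⊤` and any frame will do.
    obtain ⟨Ψ, h0, hinv, hΨ⟩ := exists_flow_chart hL hx (fun i => s (Pi.single i 1))
      (by simpa only [hs] using Pi.linearIndependent_single_one (Fin n) ℝ) (fun _ => ⊤)
      (fun _ _ _ => trivial)
    obtain ⟨e, he⟩ := hinv
    have hstrict : HasStrictFDerivAt Ψ (e : (Fin n → ℝ) →L[ℝ] (Fin n → ℝ)) 0 := by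
      rw [he]
      exact hΨ.self_of_nhds.1.hasStrictFDerivAt (by simp)
    have hmap := hstrict.map_nhds_eq_of_equiv
    rw [h0] at hmap
    rw [← hmap, Filter.eventually_map]
    filter_upwards [hΨ] with t ht
    have := ht.2.2 I
    omega
  have hclosed : ∀ x ∈ U, Module.finrank ℝ (distributionOf I x) ≠ 0 →
      ∀ᶠ z in 𝓝 x, Module.finrank ℝ (distributionOf I z) ≠ 0 := by
    intro x hx hI
    have hne : distributionOf I x ≠ ⊥ := fun h => hI (by rw [h, finrank_bot])
    obtain ⟨v, ⟨X, hX, rfl⟩, hv⟩ := Submodule.exists_mem_ne_zero_of_ne_bot hne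
    have hc : ContinuousAt X.1 x := (X.1.contDiffAt hx).continuousAt
    filter_upwards [hc.eventually_ne hv] with z hz hz0
    have : distributionOf I z = ⊥ := Submodule.finrank_eq_zero.1 hz0
    have hm : X.1 z ∈ distributionOf I z := ⟨X, hX, rfl⟩
    rw [this] at hm
    exact hz hm
  have hall : ∀ x ∈ U, Module.finrank ℝ (distributionOf I x) = 0 := by
    by_contra! hcon
    obtain ⟨x, hx, hx'⟩ := hcon
    have hpre := hU.isPreconnected
      {x | ∀ᶠ z in 𝓝 x, Module.finrank ℝ (distributionOf I z) = 0}
      {x | ∀ᶠ z in 𝓝 x, Module.finrank ℝ (distributionOf I z) ≠ 0}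
      isOpen_setOfPred_eventually_nhds isOpen_setOfPred_eventually_nhds
      (fun z hz => (em (Module.finrank ℝ (distributionOf I z) = 0)).imp (hopen z hz) (hclosed z hz))
      ⟨x₀, hx₀, hopen x₀ hx₀ h⟩ ⟨x, hx, hclosed x hx hx'⟩
    obtain ⟨z, -, hz1, hz2⟩ := hpre
    exact hz2.self_of_nhds hz1.self_of_nhds
  rw [eq_bot_iff]
  intro X hX
  refine (LieSubmodule.mem_bot X).2 (Subtype.ext (SmoothVF.ext_on fun x hx => ?_))
  have hm : X.1 x ∈ distributionOf I x := ⟨X, hX, rfl⟩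
  rw [Submodule.finrank_eq_zero.1 (hall x hx)] at hm
  exact hm

end LocalVF

/-! ### Bases adapted to a flag. -/

section AdaptedFamily

variable {E : Type*} [AddCommGroup E] [Module ℝ E] [FiniteDimensional ℝ E]

/-- A finite increasing sequence of subspaces has an adapted basis. -/
theorem exists_adapted_seq {f : ℕ → Submodule ℝ E} (hf : Monotone f) (h0 : f 0 = ⊥) (j : ℕ) :
    ∃ w : ℕ → E, ∀ q ≤ j, Submodule.span ℝ (w '' Iio (Module.finrank ℝ (f q))) = f q := by
  induction j with
  | zero =>
    refine ⟨0, fun q hq => ?_⟩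
    obtain rfl : q = 0 := by omega
    simp [h0]
  | succ j ih =>
    obtain ⟨w, hw⟩ := ih
    obtain ⟨C, hC⟩ := Submodule.exists_isCompl ((f j).comap (f (j + 1)).subtype)
    set d := Module.finrank ℝ (f j) with hd
    set d' := Module.finrank ℝ (f (j + 1)) with hd'
    have hcard : d + Module.finrank ℝ C = d' := by
      have h1 := Submodule.finrank_add_eq_of_isCompl hC
      rwa [(Submodule.comapSubtypeEquivOfLe (hf (Nat.le_succ j))).finrank_eq] at h1
    let c := Module.finBasis ℝ C
    -- The old vectors are continued by a basis of a complement of `f j` in `f (j + 1)`; the value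
    -- `0` only occurs from index `d'` on and enters none of the spans.
    let w' : ℕ → E := fun i => if i < d then w i else
      if h : i - d < Module.finrank ℝ C then ((c ⟨i - d, h⟩ : C) : f (j + 1)) else 0
    have himg : ∀ a ≤ d, w' '' Iio a = w '' Iio a := fun a ha =>
      image_congr fun i hi => if_pos (lt_of_lt_of_le hi ha)
    refine ⟨w', fun q hq => ?_⟩
    rcases Nat.lt_or_ge j q with hjq | hjq
    · obtain rfl : q = j + 1 := by omega
      have hsplit : w' '' Iio d' = w '' Iio d ∪ range fun i => ((c i : f (j + 1)) : E) := by
        ext v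
        constructor
        · rintro ⟨i, hi, rfl⟩
          by_cases hid : i < d
          · exact Or.inl ⟨i, hid, (if_pos hid).symm⟩
          · have hi' : i < d' := hi
            have h : i - d < Module.finrank ℝ C := by omega
            exact Or.inr ⟨⟨i - d, h⟩, by simp only [w', if_neg hid, dif_pos h]⟩
        · rintro (⟨i, hi, rfl⟩ | ⟨i, rfl⟩)
          · have hi' : i < d := hi
            exact ⟨i, mem_Iio.2 (by omega), if_pos hi'⟩
          · have h1 : ¬ (d + (i : ℕ) < d) := by omega
            have h2 : d + (i : ℕ) - d < Module.finrank ℝ C := by have := i.2; omega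
            refine ⟨d + i, mem_Iio.2 (by have := i.2; omega), ?_⟩
            simp only [w', if_neg h1, dif_pos h2]
            congr 3
            exact Fin.ext (by simp)
      have hrange : Submodule.span ℝ (range fun i => ((c i : f (j + 1)) : E)) =
          C.map (f (j + 1)).subtype := by
        have h1 : (range fun i => ((c i : f (j + 1)) : E)) =
            ((f (j + 1)).subtype.comp C.subtype) '' range c := by
          rw [← range_comp]; rfl
        rw [h1, Submodule.span_image, c.span_eq, Submodule.map_comp, Submodule.map_top,
          Submodule.range_subtype]
      rw [hsplit, Submodule.span_union, hw j le_rfl, hrange]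
      have h2 := congrArg (Submodule.map (f (j + 1)).subtype) hC.sup_eq_top
      rwa [Submodule.map_sup, Submodule.map_top, Submodule.range_subtype,
        Submodule.map_comap_subtype, inf_eq_right.2 (hf (Nat.le_succ j))] at h2
    · rw [himg _ (Submodule.finrank_mono (hf hjq)), hw q hjq]

/-- A finite decreasing sequence of subspaces has an adapted basis. -/
theorem exists_adapted_family {n : ℕ} (hn : Module.finrank ℝ E = n) {D : ℕ → Submodule ℝ E}
    (hD : Antitone D) {N : ℕ} (hN : D N = ⊥) :
    ∃ v : Fin n → E, ∀ q, Submodule.span ℝ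
      {x | ∃ i : Fin n, n - Module.finrank ℝ (D q) ≤ (i : ℕ) ∧ x = v i} = D q := by
  -- Both the flag and the resulting basis are reversed, so that the smaller subspaces are spanned
  -- by the vectors with the last indices.
  obtain ⟨w, hw⟩ := exists_adapted_seq (f := fun q => D (N - q))
    (fun a b hab => hD (Nat.sub_le_sub_left hab N)) hN N
  refine ⟨fun i => w (n - 1 - i), fun q => ?_⟩
  have hq : Submodule.span ℝ (w '' Iio (Module.finrank ℝ (D q))) = D q := by
    rcases Nat.lt_or_ge N q with h | h
    · have : D q = ⊥ := eq_bot_iff.2 (hN ▸ hD h.le)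
      simp [this]
    · have := hw (N - q) (Nat.sub_le _ _)
      rwa [Nat.sub_sub_self h] at this
  have hle : Module.finrank ℝ (D q) ≤ n := hn ▸ Submodule.finrank_le _
  conv_rhs => rw [← hq]
  congr 1
  ext x
  constructor
  · rintro ⟨i, hi, rfl⟩
    exact ⟨_, mem_Iio.2 (by have := i.2; omega), rfl⟩
  · rintro ⟨i, hi, rfl⟩
    have hi' : i < Module.finrank ℝ (D q) := hi
    exact ⟨⟨n - 1 - i, by omega⟩, by simp only; omega, by simp only; congr 1; omega⟩

end AdaptedFamily

theorem LinearIndependent.finrank_span_tail {E : Type*} [AddCommGroup E] [Module ℝ E] {n d : ℕ} (hd : d ≤ n) {v : Fin n → E}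
    (hv : LinearIndependent ℝ v) :
    Module.finrank ℝ (Submodule.span ℝ {x | ∃ i : Fin n, n - d ≤ (i : ℕ) ∧ x = v i}) = d := by
  let g : Fin d → Fin n := fun i => ⟨n - d + i, by have := i.2; omega⟩
  have hg : Function.Injective g := fun i j hij => by
    have := congrArg Fin.val hij
    simp only [g] at this
    exact Fin.ext (by omega)
  have hset : {x | ∃ i : Fin n, n - d ≤ (i : ℕ) ∧ x = v i} = range (v ∘ g) := by
    ext x
    constructor
    · rintro ⟨i, hi, rfl⟩
      have := i.2
      exact ⟨⟨i - (n - d), by omega⟩, congrArg v (Fin.ext (by simp only [g]; omega))⟩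
    · rintro ⟨i, rfl⟩
      exact ⟨g i, Nat.le_add_right _ _, rfl⟩
  rw [hset, finrank_span_eq_card (hv.comp g hg), Fintype.card_fin]

/-! ### Combinatorics of the drop indices. -/

section Drops

/-- If an antitone sequence drops nowhere in `[s, t)`, it is constant there. -/
theorem Antitone.eq_of_forall_not_drop {d : ℕ → ℕ} (hd : Antitone d) {s t : ℕ} (hst : s ≤ t)
    (h : ∀ i, s ≤ i → i < t → ¬ d (i + 1) < d i) : d s = d t := by
  induction t, hst using Nat.le_induction with
  | base => rfl
  | succ t hst ih =>
    rw [ih fun i h1 h2 => h i h1 (by omega)]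
    exact le_antisymm (not_lt.1 (h t hst (by omega))) (hd (Nat.le_succ t))

end Drops

namespace LocalVF

variable {n : ℕ} {U : Opens (Fin n → ℝ)} (L : LieSubalgebra ℝ (SmoothVF U))

theorem dimF_antitone : Antitone (dimF L) := fun _ _ h =>
  Submodule.finrank_mono (distributionOf_mono (nilradicalSeries_antitone h) 0)

variable {L}

theorem b_succ (j : ℕ) : b L (j + 1) = b L j + a L (j + 1) :=
  Finset.sum_Icc_succ_top (by omega) _

theorem setOf_drop_finite (hk : dimF L (height L + 1) = 0) :
    {i | dimF L (i + 1) < dimF L i}.Finite := by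
  refine (finite_le_nat (height L)).subset fun i hi => ?_
  by_contra hcon
  have hi' : dimF L (i + 1) < dimF L i := hi
  have hcon' : ¬ i ≤ height L := hcon
  have := dimF_antitone L (show height L + 1 ≤ i by omega)
  omega

theorem exists_nth_eq_of_drop (hk : dimF L (height L + 1) = 0) {i : ℕ}
    (hi : dimF L (i + 1) < dimF L i) :
    ∃ c < m L, Nat.nth (fun i => dimF L (i + 1) < dimF L i) c = i := by
  obtain ⟨c, hc, rfl⟩ := Nat.exists_lt_card_finite_nth_eq (setOf_drop_finite hk) hi
  rw [← ncard_eq_toFinset_card _ _] at hc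
  exact ⟨c, hc, rfl⟩

theorem nth_strictMono (hk : dimF L (height L + 1) = 0) {s t : ℕ} (hst : s < t) (ht : t < m L) :
    Nat.nth (fun i => dimF L (i + 1) < dimF L i) s <
      Nat.nth (fun i => dimF L (i + 1) < dimF L i) t :=
  Nat.nth_lt_nth_of_lt_card (setOf_drop_finite hk) hst
    (by rwa [← ncard_eq_toFinset_card _ _])

theorem drop_nth (hk : dimF L (height L + 1) = 0) {t : ℕ} (ht : t < m L) :
    dimF L (Nat.nth (fun i => dimF L (i + 1) < dimF L i) t + 1) <
      dimF L (Nat.nth (fun i => dimF L (i + 1) < dimF L i) t) :=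
  Nat.nth_mem_of_lt_card (p := fun i => dimF L (i + 1) < dimF L i) (setOf_drop_finite hk)
    (by rwa [← ncard_eq_toFinset_card _ _])

theorem one_le_m (hk : dimF L (height L + 1) = 0) (h0 : 0 < dimF L 0) : 1 ≤ m L := by
  by_contra hcon
  have := (dimF_antitone L).eq_of_forall_not_drop (Nat.zero_le (height L + 1)) fun i _ _ hi => by
    obtain ⟨c, hc, -⟩ := exists_nth_eq_of_drop hk hi
    omega
  omega

theorem nth_le_height (hk : dimF L (height L + 1) = 0) {t : ℕ} (ht : t < m L) :
    Nat.nth (fun i => dimF L (i + 1) < dimF L i) t ≤ height L := by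
  by_contra hcon
  have h1 := drop_nth hk ht
  have := dimF_antitone L (show height L + 1 ≤
    Nat.nth (fun i => dimF L (i + 1) < dimF L i) t by omega)
  omega

/-- The index `k` is itself a drop, from a positive dimension to zero, and no drop lies beyond it.
-/
theorem r_m_eq_height (hk : dimF L (height L + 1) = 0) (hk' : 0 < dimF L (height L)) :
    r L (m L) = height L := by
  obtain ⟨c, hc, hc'⟩ := exists_nth_eq_of_drop hk (i := height L) (by omega)
  rw [r, if_pos le_rfl]
  rcases Nat.lt_or_ge c (m L - 1) with h | h
  · have h1 := nth_strictMono hk h (by omega)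
    have h2 := nth_le_height hk (show m L - 1 < m L by omega)
    omega
  · rw [show m L - 1 = c by omega, hc']

/-- No drop lies strictly between consecutive `r_j`; for `j = m` none lies after `r_m`, which covers
the convention `r_{m+1} = k + 1`. -/
theorem dimF_r_add_one (hk : dimF L (height L + 1) = 0) {j : ℕ} (hj : 1 ≤ j) (hjm : j ≤ m L) :
    dimF L (r L j + 1) = dimF L (r L (j + 1)) := by
  have hrj : r L j = Nat.nth (fun i => dimF L (i + 1) < dimF L i) (j - 1) := if_pos hjm
  rcases Nat.lt_or_ge j (m L) with h | h
  · have hrj' : r L (j + 1) = Nat.nth (fun i => dimF L (i + 1) < dimF L i) j := if_pos h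
    rw [hrj, hrj']
    refine (dimF_antitone L).eq_of_forall_not_drop (nth_strictMono hk (by omega) h) ?_
    intro i h1 h2 hi
    obtain ⟨c, hc, rfl⟩ := exists_nth_eq_of_drop hk hi
    rcases Nat.lt_or_ge c j with hcj | hcj
    · rcases Nat.lt_or_ge c (j - 1) with h3 | h3
      · have := nth_strictMono hk h3 (by omega)
        omega
      · rw [show c = j - 1 by omega] at h1
        omega
    · rcases hcj.lt_or_eq with h3 | rfl
      · have := nth_strictMono hk h3 hc
        omega
      · exact lt_irrefl _ h2
  · have hrj' : r L (j + 1) = height L + 1 := if_neg (by omega)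
    rw [hrj, hrj']
    refine (dimF_antitone L).eq_of_forall_not_drop
      (Nat.succ_le_succ (nth_le_height hk (by omega))) ?_
    intro i h1 h2 hi
    obtain ⟨c, hc, rfl⟩ := exists_nth_eq_of_drop hk hi
    rcases Nat.lt_or_ge c (j - 1) with h3 | h3
    · have := nth_strictMono hk h3 (by omega)
      omega
    · rw [show c = j - 1 by omega] at h1
      omega

theorem dimF_r_one (hk : dimF L (height L + 1) = 0) (h0 : 0 < dimF L 0) :
    dimF L (r L 1) = dimF L 0 := by
  have hm := one_le_m hk h0
  rw [r, if_pos hm]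
  symm
  refine (dimF_antitone L).eq_of_forall_not_drop (Nat.zero_le _) fun i _ h2 hi => ?_
  obtain ⟨c, hc, rfl⟩ := exists_nth_eq_of_drop hk hi
  rcases Nat.eq_zero_or_pos c with rfl | h3
  · exact lt_irrefl _ h2
  · have := nth_strictMono hk h3 hc
    simp only [Nat.sub_self] at h2
    omega

/-- The sum defining `b_j` telescopes, as each drop ends at the dimension where the next one starts.
-/
theorem b_add_dimF (hk : dimF L (height L + 1) = 0) (h0 : 0 < dimF L 0) (j : ℕ) (hj : j ≤ m L) :
    b L j + dimF L (r L (j + 1)) = dimF L 0 := by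
  induction j with
  | zero =>
    rw [zero_add, dimF_r_one hk h0]
    simp [b]
  | succ j ih =>
    have h1 := ih (by omega)
    have h2 := dimF_r_add_one hk (show 1 ≤ j + 1 by omega) hj
    have h3 := dimF_antitone L (Nat.le_succ (r L (j + 1)))
    rw [Nat.succ_eq_add_one] at h3
    rw [b_succ, a]
    omega

end LocalVF

/-! ### The adapted frame and its chart. -/

namespace LocalVF

variable {n : ℕ} {U : Opens (Fin n → ℝ)} {L : LieSubalgebra ℝ (SmoothVF U)}

theorem V_antitone (p : Fin n → ℝ) : Antitone fun q => V L q p :=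
  fun _ _ h => distributionOf_mono (nilradicalSeries_antitone h) p

theorem V_zero (hL : IsTransitive L) {p : Fin n → ℝ} (hp : p ∈ U) : V L 0 p = ⊤ := by
  rw [eq_top_iff, ← hL p hp]
  rintro _ ⟨X, hX, rfl⟩
  exact ⟨⟨X, hX⟩, trivial, rfl⟩

theorem V_eq_bot {q : ℕ} (hq : ideal L q = ⊥) (p : Fin n → ℝ) : V L q p = ⊥ := by
  rw [V, distributionOf, hq]
  exact Submodule.map_bot _

theorem dimF_zero (h0 : (0 : Fin n → ℝ) ∈ U) (hL : IsTransitive L) : dimF L 0 = n := by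
  rw [dimF, V_zero hL h0, finrank_top, Module.finrank_fin_fun]

variable [FiniteDimensional ℝ L]

theorem nontrivial_of_isTransitive (hn : 1 ≤ n) (h0 : (0 : Fin n → ℝ) ∈ U) (hL : IsTransitive L) :
    Nontrivial L := by
  by_contra hcon
  have : Subsingleton L := not_nontrivial_iff_subsingleton.1 hcon
  have h1 := dimF_zero h0 hL
  have h2 : Module.finrank ℝ (V L 0 0) ≤ Module.finrank ℝ (ideal L 0) :=
    Submodule.finrank_map_le _ _
  have h3 : Module.finrank ℝ (ideal L 0) = 0 := Module.finrank_zero_of_subsingleton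
  rw [dimF] at h1
  omega

variable [LieAlgebra.IsSolvable L]

theorem ideal_height_add_one : ideal L (height L + 1) = ⊥ :=
  Nat.sInf_mem (s := {k | ideal L (k + 1) = ⊥}) exists_nilradicalSeries_eq_bot

theorem dimF_height_add_one : dimF L (height L + 1) = 0 := by
  rw [dimF, V_eq_bot ideal_height_add_one, finrank_bot]

theorem one_le_height (hn : 1 ≤ n) (h0 : (0 : Fin n → ℝ) ∈ U) (hL : IsTransitive L) :
    1 ≤ height L := by
  have := nontrivial_of_isTransitive hn h0 hL
  by_contra hcon
  have h := ideal_height_add_one (L := L)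
  rw [show height L = 0 by omega] at h
  exact nilradicalSeries_one_ne_bot h

theorem ideal_height_ne_bot (hn : 1 ≤ n) (h0 : (0 : Fin n → ℝ) ∈ U) (hL : IsTransitive L) :
    ideal L (height L) ≠ ⊥ := by
  intro h
  -- Minimality of `k` concerns the ideals of index `k + 1`, so it says something about `Lᵏ` only
  -- when `k ≥ 1`.
  have h1 := one_le_height hn h0 hL
  have h2 : height L ≤ height L - 1 := Nat.sInf_le (show ideal L (height L - 1 + 1) = ⊥ by
    rwa [show height L - 1 + 1 = height L by omega])
  omega

/-- `Lᵏ` is nonzero as an ideal, and an ideal whose values vanish at the origin is zero. This is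
where connectedness of `U` enters. -/
theorem dimF_height_pos (hn : 1 ≤ n) (hU : IsConnected (U : Set (Fin n → ℝ)))
    (h0 : (0 : Fin n → ℝ) ∈ U) (hL : IsTransitive L) : 0 < dimF L (height L) := by
  by_contra hcon
  exact ideal_height_ne_bot hn h0 hL
    (eq_bot_of_finrank_distributionOf_eq_zero hU hL _ h0 (by rw [dimF, V] at hcon; omega))

/-- Elements `Y₀, …, Y_{n-1}` of `L` adapted to the nilradical series at the origin. -/
theorem exists_adapted_frame (h0 : (0 : Fin n → ℝ) ∈ U) (hL : IsTransitive L) :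
    ∃ (Y : Fin n → L) (Q : Fin n → ℕ), (∀ i q, q ≤ Q i ↔ n - dimF L q ≤ (i : ℕ)) ∧
      (∀ i, Y i ∈ ideal L (Q i)) ∧ LinearIndependent ℝ fun i => (Y i).1 0 := by
  obtain ⟨v, hv⟩ := exists_adapted_family (Module.finrank_fin_fun ℝ (n := n))
    (V_antitone (L := L) 0) (V_eq_bot ideal_height_add_one 0)
  let P : Fin n → ℕ → Prop := fun i q => n - dimF L q ≤ (i : ℕ)
  have hP0 : ∀ i, P i 0 := fun i => by simp [P, dimF_zero h0 hL]
  have hPh : ∀ i q, P i q → q ≤ height L := by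
    intro i q hq
    by_contra hcon
    have h1 : dimF L q ≤ dimF L (height L + 1) := dimF_antitone L (by omega)
    rw [dimF_height_add_one] at h1
    have h2 : n - dimF L q ≤ (i : ℕ) := hq
    have := i.2
    omega
  classical
  -- The deepest level `q` for which `i` is among the last `dimF L q` indices, those whose basis
  -- vectors span `V L q 0`.
  let Q : Fin n → ℕ := fun i => Nat.findGreatest (P i) (height L)
  have hQ : ∀ i q, q ≤ Q i ↔ n - dimF L q ≤ (i : ℕ) := by
    intro i q
    refine ⟨fun hq => ?_, fun hq => Nat.le_findGreatest (hPh i q hq) hq⟩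
    have h1 : P i (Q i) := Nat.findGreatest_spec (Nat.zero_le _) (hP0 i)
    have h2 : n - dimF L (Q i) ≤ (i : ℕ) := h1
    have h3 := dimF_antitone L hq
    omega
  have hmem : ∀ i, ∃ X : L, X ∈ ideal L (Q i) ∧ X.1 0 = v i := by
    intro i
    have h1 : v i ∈ V L (Q i) 0 := by
      rw [← hv (Q i)]
      exact Submodule.subset_span ⟨i, (hQ i (Q i)).1 le_rfl, rfl⟩
    obtain ⟨X, hX, hX'⟩ := h1
    exact ⟨X, hX, hX'⟩
  choose Y hY hYv using hmem
  refine ⟨Y, Q, hQ, hY, ?_⟩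
  simp only [hYv]
  refine linearIndependent_of_top_le_span_of_card_eq_finrank ?_ (by simp)
  have h1 := hv 0
  rw [V_zero hL h0] at h1
  rw [← h1]
  refine Submodule.span_mono ?_
  rintro _ ⟨i, -, rfl⟩
  exact ⟨i, rfl⟩

/-- The coordinates given by the times of the flows of an adapted frame. -/
theorem exists_adapted_chart (h0 : (0 : Fin n → ℝ) ∈ U) (hL : IsTransitive L) :
    ∃ (Y : Fin n → L) (Q : Fin n → ℕ) (Ψ : (Fin n → ℝ) → (Fin n → ℝ)),
      (∀ i q, q ≤ Q i ↔ n - dimF L q ≤ (i : ℕ)) ∧ (∀ i, Y i ∈ ideal L (Q i)) ∧ Ψ 0 = 0 ∧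
      ∀ᶠ t in 𝓝 (0 : Fin n → ℝ), ContDiffAt ℝ ∞ Ψ t ∧ (fderiv ℝ Ψ t).IsInvertible ∧ Ψ t ∈ U ∧
        (∀ i, fderiv ℝ Ψ t (Pi.single i 1) - (Y i).1 (Ψ t) ∈ V L (Q i + 1) (Ψ t)) ∧
        (∀ q, V L q (Ψ t) = Submodule.span ℝ
          {v | ∃ i : Fin n, n - dimF L q ≤ (i : ℕ) ∧ v = (Y i).1 (Ψ t)}) ∧
        ∀ q w, fderiv ℝ Ψ t w ∈ V L q (Ψ t) ↔ ∀ i : Fin n, (i : ℕ) < n - dimF L q → w i = 0 := by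
  obtain ⟨Y, Q, hQ, hY, hlin⟩ := exists_adapted_frame h0 hL
  have hQmono : ∀ i l, i < l → Q i ≤ Q l := fun i l hil =>
    (hQ l (Q i)).2 (((hQ i (Q i)).1 le_rfl).trans (Fin.le_def.1 hil.le))
  -- For `i < l` both `Y i` and `Y l` lie in the ideal of level `Q i`, so their bracket drops to
  -- level `Q i + 1`.
  obtain ⟨Ψ, hΨ0, hinv, hΨ⟩ := exists_flow_chart hL h0 Y hlin (fun i => ideal L (Q i + 1))
    (fun i l hil => lie_mem_nilradicalSeries_succ
      (nilradicalSeries_antitone (hQmono i l hil) (hY l)) (hY i))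
  refine ⟨Y, Q, Ψ, hQ, hY, hΨ0, ?_⟩
  have hc := hΨ.self_of_nhds.1
  have hUev : ∀ᶠ t in 𝓝 (0 : Fin n → ℝ), Ψ t ∈ U :=
    hc.continuousAt.eventually (U.isOpen.mem_nhds (by rw [hΨ0]; exact h0))
  have hinvev : ∀ᶠ t in 𝓝 (0 : Fin n → ℝ), (fderiv ℝ Ψ t).IsInvertible := by
    have h1 : ContinuousAt (fderiv ℝ Ψ) 0 := (hc.fderiv_right (m := 0) (by norm_cast)).continuousAt
    refine h1.eventually (p := fun f => f.IsInvertible) ?_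
    obtain ⟨e, he⟩ := hinv
    rw [← he]
    exact ContinuousLinearEquiv.nhds e
  have hlinev : ∀ᶠ t in 𝓝 (0 : Fin n → ℝ), LinearIndependent ℝ fun i => (Y i).1 (Ψ t) := by
    have h1 : ContinuousAt (fun t => fun i => (Y i).1 (Ψ t)) 0 := continuousAt_pi.2 fun i =>
      ContinuousAt.comp (f := Ψ) (g := (Y i).1) (x := 0)
        (by rw [hΨ0]; exact ((Y i).1.contDiffAt h0).continuousAt) hc.continuousAt
    refine h1.eventually (p := fun f => LinearIndependent ℝ f)
      (isOpen_setOfPred_linearIndependent.mem_nhds ?_)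
    have hlin0 : LinearIndependent ℝ fun i => (Y i).1 (Ψ 0) := by simpa only [hΨ0] using hlin
    exact hlin0
  filter_upwards [hΨ, hUev, hinvev, hlinev] with t ht htU htinv htlin
  have hdn : ∀ q, dimF L q ≤ n := fun q => by
    have := dimF_antitone L (Nat.zero_le q)
    rwa [dimF_zero h0 hL] at this
  -- The last `dimF L q` of the vectors are independent and lie in `V L q`, whose rank at `Ψ t` is
  -- at most `dimF L q`; hence they span it. This serves both the frame `Y` and the coordinate
  -- fields.
  have hspan : ∀ (u : Fin n → (Fin n → ℝ)), LinearIndependent ℝ u →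
      (∀ i, u i ∈ V L (Q i) (Ψ t)) → ∀ q, V L q (Ψ t) = Submodule.span ℝ
        {v | ∃ i : Fin n, n - dimF L q ≤ (i : ℕ) ∧ v = u i} := by
    intro u hu hmem q
    symm
    apply Submodule.eq_of_le_of_finrank_le
    · rw [Submodule.span_le]
      rintro _ ⟨i, hi, rfl⟩
      exact V_antitone _ ((hQ i q).2 hi) (hmem i)
    · rw [hu.finrank_span_tail (hdn q)]
      have := ht.2.2 (ideal L q)
      exact this
  have hYmem : ∀ i, (Y i).1 (Ψ t) ∈ V L (Q i) (Ψ t) := fun i => ⟨Y i, hY i, rfl⟩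
  have hdiff : ∀ i, fderiv ℝ Ψ t (Pi.single i 1) - (Y i).1 (Ψ t) ∈ V L (Q i + 1) (Ψ t) := by
    intro i
    obtain ⟨Z, hZ, hZd⟩ := ht.2.1 i
    rw [hZd]
    exact ⟨Z - Y i, hZ, rfl⟩
  refine ⟨ht.1, htinv, htU, hdiff, hspan _ htlin hYmem, fun q w => ?_⟩
  obtain ⟨e, he⟩ := htinv
  let bs := (Pi.basisFun ℝ (Fin n)).map e.toLinearEquiv
  have hbs : ∀ i, bs i = fderiv ℝ Ψ t (Pi.single i 1) := by
    intro i
    rw [← he]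
    simp [bs]
  have hdmem : ∀ i, bs i ∈ V L (Q i) (Ψ t) := fun i => by
    rw [hbs]
    have := add_mem (V_antitone _ (Nat.le_succ (Q i)) (hdiff i)) (hYmem i)
    rwa [sub_add_cancel] at this
  have himage : {v | ∃ i : Fin n, n - dimF L q ≤ (i : ℕ) ∧ v = bs i} =
      bs '' {i | n - dimF L q ≤ (i : ℕ)} := by
    ext v
    exact ⟨fun ⟨i, hi, hv⟩ => ⟨i, hi, hv.symm⟩, fun ⟨i, hi, hv⟩ => ⟨i, hi, hv.symm⟩⟩
  have hrepr : ∀ i, bs.repr (fderiv ℝ Ψ t w) i = w i := by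
    intro i
    rw [← he]
    simp [bs]
  rw [hspan bs bs.linearIndependent hdmem q, himage, bs.mem_span_image]
  constructor
  · intro h i hi
    by_contra hne
    have : i ∈ ((bs.repr (fderiv ℝ Ψ t w)).support : Set (Fin n)) := by
      rw [Finset.mem_coe, Finsupp.mem_support_iff, hrepr]; exact hne
    have h2 : n - dimF L q ≤ (i : ℕ) := h this
    omega
  · intro h i hi
    rw [Finset.mem_coe, Finsupp.mem_support_iff, hrepr] at hi
    by_contra hne
    exact hi (h i (not_le.1 hne))

end LocalVF

/-! ### Coordinate systems and leaves. -/

namespace LocalVF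

variable {n : ℕ} {U : Opens (Fin n → ℝ)}

theorem mem_cube {d : ℕ} {ε : ℝ} {x : Fin d → ℝ} : x ∈ cube d ε ↔ x ∈ Metric.ball 0 ε := Iff.rfl

/-- The inverse of a local diffeomorphism, restricted to a small cube, is a coordinate system. -/
theorem exists_isCoordinates {Ψ : (Fin n → ℝ) → (Fin n → ℝ)} (h0 : Ψ 0 = 0)
    {P : (Fin n → ℝ) → Prop}
    (hΨ : ∀ᶠ t in 𝓝 (0 : Fin n → ℝ), ContDiffAt ℝ ∞ Ψ t ∧ (fderiv ℝ Ψ t).IsInvertible ∧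
      Ψ t ∈ U ∧ P t) :
    ∃ (y : OpenPartialHomeomorph (Fin n → ℝ) (Fin n → ℝ)) (ε : ℝ), IsCoordinates U y ε ∧
      (∀ t, y.symm t = Ψ t) ∧ ∀ t ∈ cube n ε, ContDiffAt ℝ ∞ Ψ t ∧
        (fderiv ℝ Ψ t).IsInvertible ∧ Ψ t ∈ U ∧ P t := by
  obtain ⟨hc, ⟨e, he⟩, -⟩ := hΨ.self_of_nhds
  have hstrict : HasStrictFDerivAt Ψ (e : (Fin n → ℝ) →L[ℝ] (Fin n → ℝ)) 0 := by
    rw [he]; exact hc.hasStrictFDerivAt (by simp)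
  set H := hstrict.toOpenPartialHomeomorph Ψ with hH
  have hH0 : (0 : Fin n → ℝ) ∈ H.source := hstrict.mem_toOpenPartialHomeomorph_source
  obtain ⟨ε, hε, hball⟩ := Metric.eventually_nhds_iff_ball.1
    (hΨ.and (H.open_source.eventually_mem hH0))
  let G := H.restrOpen (Metric.ball 0 ε) Metric.isOpen_ball
  have hG : ∀ t, G t = Ψ t := fun _ => rfl
  have hGs : G.source = Metric.ball 0 ε := by
    rw [OpenPartialHomeomorph.restrOpen_source, inter_eq_right]
    exact fun t ht => (hball t ht).2
  have h0s : (0 : Fin n → ℝ) ∈ G.source := by rw [hGs]; exact Metric.mem_ball_self hε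
  refine ⟨G.symm, ε, ⟨hε, ?_, ?_, ?_, hGs, ?_, ?_⟩, hG, fun t ht => (hball t ht).1⟩
  · have := G.map_source h0s
    rwa [hG, h0] at this
  · have := G.left_inv h0s
    rwa [hG, h0] at this
  · intro p hp
    have h1 := G.map_target hp
    rw [hGs] at h1
    have h2 := (hball _ h1).1.2.2.1
    rwa [← hG, G.right_inv hp] at h2
  · intro p hp
    have h1 := G.map_target hp
    rw [hGs] at h1
    obtain ⟨h2, ⟨e', he'⟩, -⟩ := (hball _ h1).1
    refine (G.contDiffAt_symm (f₀' := e') hp ?_ h2).contDiffWithinAt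
    rw [he']
    exact (h2.differentiableAt (by simp)).hasFDerivAt
  · intro t ht
    have h1 : t ∈ Metric.ball (0 : Fin n → ℝ) ε := by rw [← hGs]; exact ht
    exact (hball t h1).1.1.contDiffWithinAt

variable {y : OpenPartialHomeomorph (Fin n → ℝ) (Fin n → ℝ)} {ε : ℝ}

theorem IsCoordinates.mem_cube (hy : IsCoordinates U y ε) {p : Fin n → ℝ} (hp : p ∈ y.source) :
    y p ∈ cube n ε := by
  have := y.map_source hp
  rwa [hy.target_eq] at this

theorem IsCoordinates.contDiffAt (hy : IsCoordinates U y ε) {p : Fin n → ℝ} (hp : p ∈ y.source) :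
    ContDiffAt ℝ ∞ y p :=
  hy.contDiffOn.contDiffAt (y.open_source.mem_nhds hp)

theorem IsCoordinates.contDiffAt_symm (hy : IsCoordinates U y ε) {t : Fin n → ℝ}
    (ht : t ∈ y.target) : ContDiffAt ℝ ∞ y.symm t :=
  hy.contDiffOn_symm.contDiffAt (y.open_target.mem_nhds ht)

theorem IsCoordinates.fderiv_symm_fderiv (hy : IsCoordinates U y ε) {p : Fin n → ℝ}
    (hp : p ∈ y.source) (v : Fin n → ℝ) : fderiv ℝ y.symm (y p) (fderiv ℝ y p v) = v := by
  have h1 := ((hy.contDiffAt hp).differentiableAt (by simp)).hasFDerivAt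
  have h2 := ((hy.contDiffAt_symm (y.map_source hp)).differentiableAt (by simp)).hasFDerivAt
  have h3 : HasFDerivAt (y.symm ∘ y) (ContinuousLinearMap.id ℝ _) p :=
    (hasFDerivAt_id p).congr_of_eventuallyEq (y.eventually_left_inverse hp)
  exact congrArg (fun f => f v) ((h2.comp p h1).unique h3)

theorem IsCoordinates.fderiv_fderiv_symm (hy : IsCoordinates U y ε) {t : Fin n → ℝ}
    (ht : t ∈ y.target) (v : Fin n → ℝ) :
    fderiv ℝ y (y.symm t) (fderiv ℝ y.symm t v) = v := by
  have h1 := ((hy.contDiffAt (y.map_target ht)).differentiableAt (by simp)).hasFDerivAt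
  have h2 := ((hy.contDiffAt_symm ht).differentiableAt (by simp)).hasFDerivAt
  have h3 : HasFDerivAt (y ∘ y.symm) (ContinuousLinearMap.id ℝ _) t :=
    (hasFDerivAt_id t).congr_of_eventuallyEq (y.eventually_right_inverse ht)
  exact congrArg (fun f => f v) ((h1.comp t h2).unique h3)

/-- If a distribution is the common kernel of the first `c` coordinate differentials, then its leaves
are the level sets of the first `c` coordinates. -/
theorem IsCoordinates.leaf_eq (hy : IsCoordinates U y ε)
    {D : (Fin n → ℝ) → Submodule ℝ (Fin n → ℝ)} {c : ℕ}
    (hD : ∀ p ∈ y.source, ∀ v, v ∈ D p ↔ ∀ i : Fin n, (i : ℕ) < c → fderiv ℝ y p v i = 0)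
    {p : Fin n → ℝ} (hp : p ∈ y.source) :
    leaf D y.source p = {q | q ∈ y.source ∧ ∀ i : Fin n, (i : ℕ) < c → y q i = y p i} := by
  have hinv : ∀ a b, TangentJoined D y.source a b →
      ∀ i : Fin n, (i : ℕ) < c → y b i = y a i := by
    rintro _ _ ⟨γ, hγ, rfl, rfl, hγD⟩ i hi
    have hder : ∀ t ∈ Icc (0 : ℝ) 1, HasDerivWithinAt (fun t => y (γ t) i) 0 (Icc 0 1) t := by
      intro t ht
      have h1 := ((hγ t ht).differentiableWithinAt (by simp)).hasDerivWithinAt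
      have h2 := ((hy.contDiffAt (hγD t ht).1).differentiableAt (by simp)).hasFDerivAt
      have h3 := hasDerivWithinAt_pi.1 (h2.comp_hasDerivWithinAt t h1) i
      rwa [(hD _ (hγD t ht).1 _).1 (hγD t ht).2 i hi] at h3
    exact constant_of_derivWithin_zero (fun t ht => (hder t ht).differentiableWithinAt)
      (fun t ht => (hder t (Ico_subset_Icc_self ht)).derivWithin
        (uniqueDiffOn_Icc zero_lt_one t (Ico_subset_Icc_self ht))) 1 ⟨zero_le_one, le_rfl⟩
  have hgen : ∀ a b, Relation.EqvGen (TangentJoined D y.source) a b →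
      ∀ i : Fin n, (i : ℕ) < c → y b i = y a i := by
    intro a b hab
    induction hab with
    | rel a b h => exact hinv a b h
    | refl a => exact fun _ _ => rfl
    | symm a b _ ih => exact fun i hi => (ih i hi).symm
    | trans a b d _ _ ih1 ih2 => exact fun i hi => (ih2 i hi).trans (ih1 i hi)
  ext q
  refine ⟨fun h => ⟨h.1, hgen _ _ h.2⟩, fun ⟨hq, hpq⟩ => ⟨hq, Relation.EqvGen.rel _ _ ?_⟩⟩
  -- The cube is convex, so two points of a level set are joined by one tangent curve, a straight
  -- segment in the coordinates.
  · have hseg : ∀ t ∈ Icc (0 : ℝ) 1, y p + t • (y q - y p) ∈ y.target := by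
      intro t ht
      have h1 := hy.mem_cube hp
      have h2 := hy.mem_cube hq
      rw [hy.target_eq]
      exact (convex_ball (0 : Fin n → ℝ) ε).add_smul_sub_mem h1 h2 ht
    have hline : ∀ t : ℝ, HasDerivAt (fun t : ℝ => y p + t • (y q - y p)) (y q - y p) t := by
      intro t
      simpa using ((hasDerivAt_id t).smul_const (y q - y p)).const_add (y p)
    refine ⟨fun t => y.symm (y p + t • (y q - y p)), fun t ht => ?_, ?_, ?_, fun t ht => ?_⟩
    · refine (ContDiffAt.comp (f := fun t : ℝ => y p + t • (y q - y p)) t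
        ((hy.contDiffAt_symm (hseg t ht)).of_le ?_) (by fun_prop)).contDiffWithinAt
      exact_mod_cast le_top
    · simp [y.left_inv hp]
    · simp [y.left_inv hq]
    · refine ⟨y.map_target (hseg t ht), ?_⟩
      have h1 := ((hy.contDiffAt_symm (hseg t ht)).differentiableAt (by simp)).hasFDerivAt
      have h2 := (h1.comp_hasDerivAt t (hline t)).hasDerivWithinAt.derivWithin
        (uniqueDiffOn_Icc zero_lt_one t ht)
      have h3 : derivWithin (fun t : ℝ => y.symm (y p + t • (y q - y p))) (Icc 0 1) t =
        fderiv ℝ y.symm (y p + t • (y q - y p)) (y q - y p) := h2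
      rw [h3, hD _ (y.map_target (hseg t ht))]
      intro i hi
      rw [hy.fderiv_fderiv_symm (hseg t ht), Pi.sub_apply, hpq i hi, sub_self]

end LocalVF

/-! ### Charts fibred by an abelian ideal, and projection to the base. -/

namespace LocalVF

variable {n : ℕ} {U : Opens (Fin n → ℝ)}

theorem castLE_mem_cube {c : ℕ} (hc : c ≤ n) {ε : ℝ} {t : Fin n → ℝ} (ht : t ∈ cube n ε) :
    firstEntries hc t ∈ cube c ε := by
  rw [mem_cube, mem_ball_zero_iff] at ht ⊢
  have hε : 0 < ε := (norm_nonneg _).trans_lt ht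
  exact (pi_norm_lt_iff hε).2 fun i => (pi_norm_lt_iff hε).1 ht (Fin.castLE hc i)

/-- The projection on the first `c` coordinates as a continuous linear map. -/
def firstCLM {c : ℕ} (hc : c ≤ n) : (Fin n → ℝ) →L[ℝ] (Fin c → ℝ) :=
  ContinuousLinearMap.pi fun i => ContinuousLinearMap.proj (Fin.castLE hc i)

theorem firstCLM_apply {c : ℕ} (hc : c ≤ n) (t : Fin n → ℝ) : firstCLM hc t = firstEntries hc t :=
  rfl

/-- The inclusion of `ℝᶜ` in `ℝⁿ` as the first `c` coordinates. -/
def zeroExtend (n c : ℕ) : (Fin c → ℝ) →L[ℝ] (Fin n → ℝ) :=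
  ContinuousLinearMap.pi fun i =>
    if h : (i : ℕ) < c then ContinuousLinearMap.proj ⟨i, h⟩ else 0

theorem zeroExtend_of_lt {c : ℕ} (u : Fin c → ℝ) {i : Fin n} (hi : (i : ℕ) < c) :
    zeroExtend n c u i = u ⟨i, hi⟩ := by
  simp [zeroExtend, hi]

theorem zeroExtend_of_le {c : ℕ} (u : Fin c → ℝ) {i : Fin n} (hi : c ≤ (i : ℕ)) :
    zeroExtend n c u i = 0 := by
  simp [zeroExtend, not_lt.2 hi]

theorem firstEntries_zeroExtend {c : ℕ} (hc : c ≤ n) (u : Fin c → ℝ) :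
    firstEntries hc (zeroExtend n c u) = u :=
  funext fun i => zeroExtend_of_lt u (i := Fin.castLE hc i) i.2

theorem zeroExtend_mem_cube {c : ℕ} {ε : ℝ} {u : Fin c → ℝ} (hu : u ∈ cube c ε) :
    zeroExtend n c u ∈ cube n ε := by
  rw [mem_cube, mem_ball_zero_iff] at hu ⊢
  have hε : 0 < ε := (norm_nonneg _).trans_lt hu
  refine (pi_norm_lt_iff hε).2 fun i => ?_
  rcases Nat.lt_or_ge i c with hi | hi
  · rw [zeroExtend_of_lt u hi]
    exact (pi_norm_lt_iff hε).1 hu _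
  · rw [zeroExtend_of_le u hi, norm_zero]
    exact hε

/-- A function on a cube whose derivatives in the last coordinates depend only on the first `c`
coordinates is affine in the last coordinates. -/
theorem eq_add_sum_of_fderiv_eq {c : ℕ} (hc : c ≤ n) {ε : ℝ} {h : (Fin n → ℝ) → ℝ}
    (hd : ∀ t ∈ cube n ε, DifferentiableAt ℝ h t) {f : Fin n → (Fin c → ℝ) → ℝ}
    (hf : ∀ t ∈ cube n ε, ∀ i : Fin n, c ≤ (i : ℕ) →
      fderiv ℝ h t (Pi.single i 1) = f i (firstEntries hc t)) {t : Fin n → ℝ} (ht : t ∈ cube n ε) :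
    h t = ∑ i ∈ Finset.univ.filter fun i : Fin n => c ≤ (i : ℕ), f i (firstEntries hc t) * t i +
      h (zeroExtend n c (firstEntries hc t)) := by
  set u := firstEntries hc t with hu
  set t₀ := zeroExtend n c u with ht₀
  set w := t - t₀ with hw
  have ht₀m : t₀ ∈ cube n ε := zeroExtend_mem_cube (castLE_mem_cube hc ht)
  have hseg : ∀ s ∈ Icc (0 : ℝ) 1, t₀ + s • w ∈ cube n ε := fun s hs =>
    (convex_ball (0 : Fin n → ℝ) ε).add_smul_sub_mem ht₀m ht hs
  have hw0 : ∀ i : Fin n, (i : ℕ) < c → w i = 0 := by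
    intro i hi
    rw [hw, Pi.sub_apply, ht₀, zeroExtend_of_lt u hi]
    exact sub_self _
  have hw1 : ∀ i : Fin n, c ≤ (i : ℕ) → w i = t i := by
    intro i hi
    rw [hw, Pi.sub_apply, ht₀, zeroExtend_of_le u hi, sub_zero]
  have hfirst : ∀ s : ℝ, firstEntries hc (t₀ + s • w) = u := by
    intro s
    refine funext fun i => ?_
    have h1 : w (Fin.castLE hc i) = 0 := hw0 _ i.2
    have h2 : t₀ (Fin.castLE hc i) = u i := zeroExtend_of_lt u (i := Fin.castLE hc i) i.2
    simp only [firstEntries, Pi.add_apply, Pi.smul_apply, h1, h2, smul_zero, add_zero]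
  set A := ∑ i ∈ Finset.univ.filter fun i : Fin n => c ≤ (i : ℕ), f i u * t i with hA
  have hwsum : w = ∑ i, w i • (Pi.single i 1 : Fin n → ℝ) := by
    simpa using (pi_eq_sum_univ' w)
  -- On the segment from the point `t₀` with zero fibre coordinates to `t`, the first `c`
  -- coordinates are fixed, so the derivative is the constant `A`.
  have hder : ∀ s ∈ Icc (0 : ℝ) 1, HasDerivAt (fun s : ℝ => h (t₀ + s • w)) A s := by
    intro s hs
    have h1 : HasDerivAt (fun s : ℝ => t₀ + s • w) w s := by
      simpa using ((hasDerivAt_id s).smul_const w).const_add t₀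
    refine ((hd _ (hseg s hs)).hasFDerivAt.comp_hasDerivAt s h1).congr_deriv ?_
    have h2 : ∀ D : (Fin n → ℝ) →L[ℝ] ℝ, D w = ∑ i, w i * D (Pi.single i 1) := by
      intro D
      refine (congrArg D hwsum).trans ?_
      rw [map_sum]
      exact Finset.sum_congr rfl fun i _ => map_smul D _ _
    rw [h2, hA, Finset.sum_filter]
    refine Finset.sum_congr rfl fun i _ => ?_
    split_ifs with hi
    · rw [hf _ (hseg s hs) i hi, hfirst, hw1 i hi, mul_comm]
    · rw [hw0 i (not_le.1 hi), zero_mul]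
  have hder' : ∀ s ∈ Icc (0 : ℝ) 1,
      HasDerivWithinAt (fun s : ℝ => h (t₀ + s • w) - s * A) 0 (Icc 0 1) s := fun s hs =>
    (((hder s hs).sub ((hasDerivAt_id s).mul_const A)).congr_deriv
      (by rw [one_mul, sub_self])).hasDerivWithinAt
  have hconst := constant_of_derivWithin_zero
    (fun s hs => (hder' s hs).differentiableWithinAt)
    (fun s hs => (hder' s (Ico_subset_Icc_self hs)).derivWithin
      (uniqueDiffOn_Icc zero_lt_one s (Ico_subset_Icc_self hs))) 1 ⟨zero_le_one, le_rfl⟩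
  have e1 : t₀ + (1 : ℝ) • w = t := by rw [one_smul, hw, add_sub_cancel]
  simp only [e1, one_mul, zero_smul, add_zero, zero_mul, sub_zero] at hconst
  linarith

/-- The expression of an element of `L` in the chart given by a parametrization `Ψ`. -/
noncomputable def pull {L : LieSubalgebra ℝ (SmoothVF U)} (Ψ : (Fin n → ℝ) → (Fin n → ℝ)) (X : L) :
    (Fin n → ℝ) → (Fin n → ℝ) :=
  VectorField.pullback ℝ Ψ X.1

/-- A parametrization `Ψ` of an open set by a cube in which the last coordinate vector fields are
values of elements `Y i` of an abelian ideal `K`, tangent to the last coordinates. -/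
structure FibredChart (L : LieSubalgebra ℝ (SmoothVF U)) (K : LieIdeal ℝ L)
    (Ψ : (Fin n → ℝ) → (Fin n → ℝ)) (Y : Fin n → L) (c : ℕ) (ε : ℝ) : Prop where
  le : c ≤ n
  contDiffAt : ∀ t ∈ cube n ε, ContDiffAt ℝ ∞ Ψ t
  isInvertible : ∀ t ∈ cube n ε, (fderiv ℝ Ψ t).IsInvertible
  mem : ∀ t ∈ cube n ε, Ψ t ∈ U
  Y_mem : ∀ i : Fin n, c ≤ (i : ℕ) → Y i ∈ K
  fderiv_eq : ∀ t ∈ cube n ε, ∀ i : Fin n, c ≤ (i : ℕ) →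
    fderiv ℝ Ψ t (Pi.single i 1) = (Y i).1 (Ψ t)
  eq_zero : ∀ X ∈ K, ∀ t ∈ cube n ε, ∀ w, fderiv ℝ Ψ t w = X.1 (Ψ t) →
    ∀ i : Fin n, (i : ℕ) < c → w i = 0
  comm : ∀ X ∈ K, ∀ Z ∈ K, ⁅X, Z⁆ = 0

namespace FibredChart

variable {L : LieSubalgebra ℝ (SmoothVF U)} {K : LieIdeal ℝ L} {Ψ : (Fin n → ℝ) → (Fin n → ℝ)}
  {Y : Fin n → L} {c : ℕ} {ε : ℝ}

theorem fderiv_pull (H : FibredChart L K Ψ Y c ε) (X : L) {t : Fin n → ℝ} (ht : t ∈ cube n ε) :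
    fderiv ℝ Ψ t (pull Ψ X t) = X.1 (Ψ t) :=
  (H.isInvertible t ht).self_apply_inverse _

theorem pull_add (X Z : L) (t : Fin n → ℝ) : pull Ψ (X + Z) t = pull Ψ X t + pull Ψ Z t :=
  map_add (fderiv ℝ Ψ t).inverse (X.1 (Ψ t)) (Z.1 (Ψ t))

theorem pull_smul (r : ℝ) (X : L) (t : Fin n → ℝ) : pull Ψ (r • X) t = r • pull Ψ X t :=
  map_smul (fderiv ℝ Ψ t).inverse r (X.1 (Ψ t))

theorem contDiffAt_pull (H : FibredChart L K Ψ Y c ε) (X : L) {t : Fin n → ℝ}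
    (ht : t ∈ cube n ε) : ContDiffAt ℝ ∞ (pull Ψ X) t := by
  have h1 : ContDiffAt ℝ ∞ (fderiv ℝ Ψ) t := (H.contDiffAt t ht).fderiv_right (by norm_cast)
  exact ((H.isInvertible t ht).contDiffAt_map_inverse.comp t h1).clm_apply
    ((X.1.contDiffAt (H.mem t ht)).comp t (H.contDiffAt t ht))

theorem pull_lie (H : FibredChart L K Ψ Y c ε) (X Z : L) {t : Fin n → ℝ} (ht : t ∈ cube n ε) :
    pull Ψ ⁅X, Z⁆ t = VectorField.lieBracket ℝ (pull Ψ X) (pull Ψ Z) t := by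
  have h1 := VectorField.pullback_lieBracket (𝕜 := ℝ) (n := ∞)
    (by simp only [minSmoothness_of_isRCLikeNormedField]
        exact WithTop.coe_le_coe.2 (le_top : (2 : ℕ∞) ≤ ⊤))
    (H.contDiffAt t ht) (X.1.differentiableAt (H.mem t ht)) (Z.1.differentiableAt (H.mem t ht))
  rw [pull, pull, pull, ← h1]
  exact congrArg (fderiv ℝ Ψ t).inverse (SmoothVF.bracket_apply X.1 Z.1 (H.mem t ht))

theorem pull_frame (H : FibredChart L K Ψ Y c ε) {t : Fin n → ℝ} (ht : t ∈ cube n ε) {i : Fin n}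
    (hi : c ≤ (i : ℕ)) : pull Ψ (Y i) t = Pi.single i 1 := by
  refine (H.isInvertible t ht).injective ?_
  rw [H.fderiv_pull (Y i) ht, H.fderiv_eq t ht i hi]

/-- In the chart `Y i` is a constant coordinate field, and bracketing with such a field is
differentiation in that coordinate. -/
theorem fderiv_pull_single (H : FibredChart L K Ψ Y c ε) (X : L) {t : Fin n → ℝ}
    (ht : t ∈ cube n ε) {i : Fin n} (hi : c ≤ (i : ℕ)) :
    fderiv ℝ (pull Ψ X) t (Pi.single i 1) = pull Ψ ⁅Y i, X⁆ t := by
  rw [H.pull_lie _ _ ht, VectorField.lieBracket_eq]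
  have h1 : fderiv ℝ (pull Ψ (Y i)) t = 0 := by
    have : pull Ψ (Y i) =ᶠ[𝓝 t] fun _ => Pi.single i 1 := by
      filter_upwards [(cube n ε).isOpen.mem_nhds ht] with z hz
      exact H.pull_frame hz hi
    rw [this.fderiv_eq]
    simp
  simp only [h1, H.pull_frame ht hi, zero_apply, sub_zero]

theorem fderiv_pull_apply_single (H : FibredChart L K Ψ Y c ε) (X : L) {t : Fin n → ℝ}
    (ht : t ∈ cube n ε) {i : Fin n} (hi : c ≤ (i : ℕ)) (j : Fin n) :
    fderiv ℝ (fun t => pull Ψ X t j) t (Pi.single i 1) = pull Ψ ⁅Y i, X⁆ t j := by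
  rw [← H.fderiv_pull_single X ht hi]
  have h1 := ((H.contDiffAt_pull X ht).differentiableAt (by simp)).hasFDerivAt
  have h2 := hasFDerivAt_pi'.1 h1 j
  rw [h2.fderiv]
  rfl

theorem pull_eq_zero (H : FibredChart L K Ψ Y c ε) {X : L} (hX : X ∈ K) {t : Fin n → ℝ}
    (ht : t ∈ cube n ε) {i : Fin n} (hi : (i : ℕ) < c) : pull Ψ X t i = 0 :=
  H.eq_zero X hX t ht _ (H.fderiv_pull X ht) i hi

theorem differentiableAt_pull_apply (H : FibredChart L K Ψ Y c ε) (X : L) {t : Fin n → ℝ}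
    (ht : t ∈ cube n ε) (j : Fin n) : DifferentiableAt ℝ (fun t => pull Ψ X t j) t :=
  differentiableAt_pi.1 ((H.contDiffAt_pull X ht).differentiableAt (by simp)) j

/-- A component which commutes with the frame of the fibres depends only on the base point. -/
theorem pull_apply_eq_of_forall_lie (H : FibredChart L K Ψ Y c ε) (X : L) (j : Fin n)
    (hX : ∀ t ∈ cube n ε, ∀ i : Fin n, c ≤ (i : ℕ) → pull Ψ ⁅Y i, X⁆ t j = 0) {t : Fin n → ℝ}
    (ht : t ∈ cube n ε) :
    pull Ψ X t j = pull Ψ X (zeroExtend n c (firstEntries H.le t)) j := by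
  have := eq_add_sum_of_fderiv_eq H.le (h := fun t => pull Ψ X t j) (f := fun _ _ => 0)
    (fun t ht => H.differentiableAt_pull_apply X ht j)
    (fun t ht i hi => by rw [H.fderiv_pull_apply_single X ht hi, hX t ht i hi]) ht
  simpa using this

theorem pull_zero (t : Fin n → ℝ) : pull Ψ (0 : L) t = 0 :=
  map_zero (fderiv ℝ Ψ t).inverse

/-- The derivatives in question are base components of `[Y i, X]`, an element of `K`, which is
tangent to the fibres. -/
theorem pull_apply_of_lt (H : FibredChart L K Ψ Y c ε) (X : L) {t : Fin n → ℝ}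
    (ht : t ∈ cube n ε) {j : Fin n} (hj : (j : ℕ) < c) :
    pull Ψ X t j = pull Ψ X (zeroExtend n c (firstEntries H.le t)) j :=
  H.pull_apply_eq_of_forall_lie X j (fun _ ht i hi =>
    H.pull_eq_zero (lie_mem_left ℝ L K _ _ (H.Y_mem i hi)) ht hj) ht

theorem pull_apply_of_mem (H : FibredChart L K Ψ Y c ε) {X : L} (hX : X ∈ K) {t : Fin n → ℝ}
    (ht : t ∈ cube n ε) (j : Fin n) :
    pull Ψ X t j = pull Ψ X (zeroExtend n c (firstEntries H.le t)) j :=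
  H.pull_apply_eq_of_forall_lie X j (fun _ _ i hi => by
    rw [H.comm _ (H.Y_mem i hi) _ hX, pull_zero, Pi.zero_apply]) ht

/-- The expression of an element of `L` is affine along the fibres. -/
theorem pull_apply_eq_add_sum (H : FibredChart L K Ψ Y c ε) (X : L) {t : Fin n → ℝ}
    (ht : t ∈ cube n ε) (j : Fin n) :
    pull Ψ X t j = ∑ i ∈ Finset.univ.filter fun i : Fin n => c ≤ (i : ℕ),
        pull Ψ ⁅Y i, X⁆ (zeroExtend n c (firstEntries H.le t)) j * t i +
      pull Ψ X (zeroExtend n c (firstEntries H.le t)) j :=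
  eq_add_sum_of_fderiv_eq H.le (h := fun t => pull Ψ X t j)
    (f := fun i u => pull Ψ ⁅Y i, X⁆ (zeroExtend n c u) j)
    (fun _ ht => H.differentiableAt_pull_apply X ht j)
    -- The slopes are components of `[Y i, X] ∈ K`, and these are constant along the fibres because
    -- `K` is abelian.
    (fun t ht i hi => by
      rw [H.fderiv_pull_apply_single X ht hi,
        H.pull_apply_of_mem (lie_mem_left ℝ L K _ _ (H.Y_mem i hi)) ht]) ht

theorem contDiffOn_pull_zeroExtend (H : FibredChart L K Ψ Y c ε) (X : L) (j : Fin n) :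
    ContDiffOn ℝ ∞ (fun u => pull Ψ X (zeroExtend n c u) j) (cube c ε) := by
  intro u hu
  have h1 := (H.contDiffAt_pull X (zeroExtend_mem_cube hu)).comp u
    (zeroExtend n c).contDiff.contDiffAt
  exact (contDiffAt_pi.1 h1 j).contDiffWithinAt

open Classical in
/-- The projection of an element of `L` to the space of the first `c` coordinates. -/
noncomputable def projVF (H : FibredChart L K Ψ Y c ε) (X : L) : SmoothVF (cube c ε) :=
  ⟨fun u => if u ∈ cube c ε then firstEntries H.le (pull Ψ X (zeroExtend n c u)) else 0, by
    refine ⟨ContDiffOn.congr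
      (f := fun u => firstEntries H.le (pull Ψ X (zeroExtend n c u))) ?_ fun u hu => if_pos hu,
      fun u hu => if_neg hu⟩
    exact contDiffOn_pi.2 fun i => H.contDiffOn_pull_zeroExtend X (Fin.castLE H.le i)⟩

theorem projVF_apply (H : FibredChart L K Ψ Y c ε) (X : L) {u : Fin c → ℝ} (hu : u ∈ cube c ε) :
    H.projVF X u = firstEntries H.le (pull Ψ X (zeroExtend n c u)) := if_pos hu

theorem projVF_firstEntries (H : FibredChart L K Ψ Y c ε) (X : L) {t : Fin n → ℝ}
    (ht : t ∈ cube n ε) : H.projVF X (firstEntries H.le t) = firstEntries H.le (pull Ψ X t) := by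
  rw [H.projVF_apply X (castLE_mem_cube H.le ht)]
  exact funext fun i => (H.pull_apply_of_lt X ht (j := Fin.castLE H.le i) i.2).symm

/-- The linear projection intertwines `pull Ψ X` with its projection on the whole cube, so this is
the chain rule; it makes the projection compatible with brackets. -/
theorem fderiv_projVF (H : FibredChart L K Ψ Y c ε) (X : L) {u : Fin c → ℝ} (hu : u ∈ cube c ε)
    (w : Fin n → ℝ) : fderiv ℝ (H.projVF X) u (firstEntries H.le w) =
      firstEntries H.le (fderiv ℝ (pull Ψ X) (zeroExtend n c u) w) := by
  have hs := zeroExtend_mem_cube (n := n) hu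
  have h1 : HasFDerivAt (H.projVF X).1 (fderiv ℝ (H.projVF X) u) (firstCLM H.le (zeroExtend n c u)) := by
    rw [firstCLM_apply, firstEntries_zeroExtend]
    exact ((H.projVF X).differentiableAt hu).hasFDerivAt
  have h2 := h1.comp _ (firstCLM H.le).hasFDerivAt
  have h3 := (firstCLM H.le).hasFDerivAt.comp _
    ((H.contDiffAt_pull X hs).differentiableAt (by simp)).hasFDerivAt
  have h4 : (H.projVF X).1 ∘ firstCLM H.le =ᶠ[𝓝 (zeroExtend n c u)]
      firstCLM H.le ∘ pull Ψ X := by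
    filter_upwards [(cube n ε).isOpen.mem_nhds hs] with z hz
    exact H.projVF_firstEntries X hz
  exact congrArg (fun f => f w) ((h3.congr_of_eventuallyEq h4).unique h2).symm

/-- The projection to the space of the first `c` coordinates is a homomorphism of Lie algebras. -/
noncomputable def projHom (H : FibredChart L K Ψ Y c ε) : L →ₗ⁅ℝ⁆ SmoothVF (cube c ε) where
  toFun := H.projVF
  map_add' X Z := SmoothVF.ext_on fun u hu => by
    rw [SmoothVF.add_coe, Pi.add_apply, H.projVF_apply _ hu, H.projVF_apply _ hu,
      H.projVF_apply _ hu, pull_add]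
    rfl
  map_smul' r X := SmoothVF.ext_on fun u hu => by
    rw [RingHom.id_apply, SmoothVF.smul_coe, Pi.smul_apply, H.projVF_apply _ hu,
      H.projVF_apply _ hu, pull_smul]
    rfl
  map_lie' {X Z} := SmoothVF.ext_on fun u hu => by
    rw [SmoothVF.bracket_apply _ _ hu, H.projVF_apply _ hu, H.pull_lie X Z (zeroExtend_mem_cube hu),
      VectorField.lieBracket_eq, VectorField.lieBracket_eq]
    dsimp only
    rw [H.projVF_apply X hu, H.projVF_apply Z hu, H.fderiv_projVF X hu, H.fderiv_projVF Z hu]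
    rfl

theorem isTransitive_range (H : FibredChart L K Ψ Y c ε) (hL : IsTransitive L) :
    IsTransitive H.projHom.range := by
  intro u hu
  rw [eq_top_iff]
  intro v _
  have hs := zeroExtend_mem_cube (n := n) hu
  have hv : fderiv ℝ Ψ (zeroExtend n c u) (zeroExtend n c v) ∈
      L.toSubmodule.map (SmoothVF.evalAt (Ψ (zeroExtend n c u))) := by
    rw [hL _ (H.mem _ hs)]; trivial
  obtain ⟨X, hX, hXv⟩ := hv
  refine ⟨H.projHom ⟨X, hX⟩, ⟨⟨X, hX⟩, rfl⟩, ?_⟩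
  have h1 : pull Ψ (⟨X, hX⟩ : L) (zeroExtend n c u) = zeroExtend n c v := by
    refine (H.isInvertible _ hs).injective ?_
    rw [H.fderiv_pull _ hs]
    exact hXv
  calc H.projVF ⟨X, hX⟩ u = firstEntries H.le (pull Ψ (⟨X, hX⟩ : L) (zeroExtend n c u)) :=
        H.projVF_apply _ hu
    _ = v := by rw [h1, firstEntries_zeroExtend]

end FibredChart

end LocalVF

/-- A sum over `Fin n` splits into the sum over the first `c` indices and the sum over the rest. -/
theorem Fin.sum_filter_add_sum_castLE {M : Type*} [AddCommMonoid M] {n c : ℕ} (h : c ≤ n)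
    (f : Fin n → M) :
    ∑ j ∈ Finset.univ.filter (fun j : Fin n => c ≤ (j : ℕ)), f j + ∑ i, f (Fin.castLE h i) =
      ∑ j, f j := by
  rw [← Finset.sum_filter_add_sum_filter_not Finset.univ (fun j : Fin n => c ≤ (j : ℕ)) f]
  congr 1
  refine Finset.sum_bij (fun i _ => Fin.castLE h i) (fun i _ => ?_)
    (fun i _ j _ hij => Fin.castLE_injective h hij) (fun j hj => ?_) fun _ _ => rfl
  · simp
  · exact ⟨⟨j, not_le.1 (Finset.mem_filter.1 hj).2⟩, Finset.mem_univ _, rfl⟩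

/-! ### Assembly of the coordinates, the frame and the projection. -/

open LocalVF in
theorem proposition3p5 {n : ℕ} (hn : 1 ≤ n) (U : TopologicalSpace.Opens (Fin n → ℝ))
    (hU : IsConnected (U : Set (Fin n → ℝ))) (h0 : (0 : Fin n → ℝ) ∈ U)
    (L : LieSubalgebra ℝ (SmoothVF U)) [FiniteDimensional ℝ L] [LieAlgebra.IsSolvable L]
    (hL : LocalVF.IsTransitive L) :
    ∃ (y : OpenPartialHomeomorph (Fin n → ℝ) (Fin n → ℝ)) (ε : ℝ) (Y : Fin n → L)
      (hb : LocalVF.b L (LocalVF.m L - 1) ≤ n)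
      (π : L →ₗ⁅ℝ⁆ SmoothVF (LocalVF.cube (LocalVF.b L (LocalVF.m L - 1)) ε)),
      LocalVF.IsCoordinates U y ε ∧
      -- (1) the first `b_j` coordinates define `𝓕^{r_{j+1}}` as their level sets
      (∀ j ∈ Finset.Icc 1 (LocalVF.m L), ∀ p ∈ y.source,
        (∀ v : Fin n → ℝ, v ∈ LocalVF.V L (LocalVF.r L (j + 1)) p ↔
          ∀ i : Fin n, (i : ℕ) < LocalVF.b L j → fderiv ℝ y p v i = 0) ∧
        LocalVF.leaf (LocalVF.V L (LocalVF.r L (j + 1))) y.source p =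
          {q | q ∈ y.source ∧ ∀ i : Fin n, (i : ℕ) < LocalVF.b L j → y q i = y p i}) ∧
      -- (2) generators of `𝓕^{r_j}`, and `Y_i = ∂_{y^i}` modulo `𝓕^{r_{j+1}}`
      (∀ j ∈ Finset.Icc 1 (LocalVF.m L), ∀ p ∈ y.source,
        LocalVF.V L (LocalVF.r L j) p =
          Submodule.span ℝ {v | ∃ i : Fin n, LocalVF.b L (j - 1) ≤ (i : ℕ) ∧ v = (Y i).1 p} ∧
        ∀ i : Fin n, LocalVF.b L (j - 1) ≤ (i : ℕ) → (i : ℕ) < LocalVF.b L j →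
          (Y i).1 p - LocalVF.partialVF y i p ∈ LocalVF.V L (LocalVF.r L (j + 1)) p) ∧
      -- (3) the generators of `𝓕^k` are coordinate vector fields belonging to `L^k`
      (∀ p ∈ y.source, LocalVF.V L (LocalVF.height L) p =
        Submodule.span ℝ {v | ∃ i : Fin n, LocalVF.b L (LocalVF.m L - 1) ≤ (i : ℕ) ∧
          v = (Y i).1 p}) ∧
      (∀ i : Fin n, LocalVF.b L (LocalVF.m L - 1) ≤ (i : ℕ) →
        Y i ∈ LocalVF.ideal L (LocalVF.height L) ∧
        ∀ p ∈ y.source, (Y i).1 p = LocalVF.partialVF y i p) ∧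
      -- (4) the form of the elements of `L`, where `π X` is the vector field `X̄`
      (∀ X : L, ∃ (f : Fin n → Fin n → (Fin (LocalVF.b L (LocalVF.m L - 1)) → ℝ) → ℝ)
          (g : Fin n → (Fin (LocalVF.b L (LocalVF.m L - 1)) → ℝ) → ℝ),
        (∀ i j, ContDiffOn ℝ ∞ (f i j) (LocalVF.cube (LocalVF.b L (LocalVF.m L - 1)) ε)) ∧
        (∀ j, ContDiffOn ℝ ∞ (g j) (LocalVF.cube (LocalVF.b L (LocalVF.m L - 1)) ε)) ∧
        ∀ p ∈ y.source, X.1 p =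
          ∑ j ∈ Finset.univ.filter fun j : Fin n => LocalVF.b L (LocalVF.m L - 1) ≤ (j : ℕ),
            (∑ i ∈ Finset.univ.filter fun i : Fin n => LocalVF.b L (LocalVF.m L - 1) ≤ (i : ℕ),
                f i j (LocalVF.firstEntries hb (y p)) * y p i
              + g j (LocalVF.firstEntries hb (y p))) • LocalVF.partialVF y j p
          + ∑ i, π X (LocalVF.firstEntries hb (y p)) i •
              LocalVF.partialVF y (Fin.castLE hb i) p) ∧
      -- the form of the elements of `L^1`
      (∀ X ∈ LocalVF.ideal L 1,
        ∃ u : Fin n → (Fin (LocalVF.b L (LocalVF.m L - 1)) → ℝ) → ℝ,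
        (∀ j, ContDiffOn ℝ ∞ (u j) (LocalVF.cube (LocalVF.b L (LocalVF.m L - 1)) ε)) ∧
        ∀ p ∈ y.source, X.1 p =
          ∑ j ∈ Finset.univ.filter fun j : Fin n => LocalVF.b L (LocalVF.m L - 1) ≤ (j : ℕ),
            u j (LocalVF.firstEntries hb (y p)) • LocalVF.partialVF y j p
          + ∑ i, π X (LocalVF.firstEntries hb (y p)) i •
              LocalVF.partialVF y (Fin.castLE hb i) p) ∧
      -- (5) the fields `X̄` form a transitive solvable Lie algebra in `b_{m-1} = n - a_m` variables
      LieAlgebra.IsSolvable π.range ∧ FiniteDimensional ℝ π.range ∧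
      LocalVF.IsTransitive π.range ∧
      LocalVF.b L (LocalVF.m L - 1) + LocalVF.a L (LocalVF.m L) = n := by
  have hhF := dimF_height_add_one (L := L)
  have hdim0 : dimF L 0 = n := dimF_zero h0 hL
  have hdimpos : 0 < dimF L 0 := hdim0.symm ▸ hn
  have hhpos : 0 < dimF L (height L) := dimF_height_pos hn hU h0 hL
  have h1m : 1 ≤ m L := one_le_m hhF hdimpos
  have hrm : r L (m L) = height L := r_m_eq_height hhF hhpos
  have hbd : ∀ j ≤ m L, b L j + dimF L (r L (j + 1)) = n := fun j hj =>
    (b_add_dimF hhF hdimpos j hj).trans hdim0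
  have hbsub : ∀ j ≤ m L, n - dimF L (r L (j + 1)) = b L j := fun j hj => by
    have := hbd j hj; omega
  have hbsub' : ∀ j, 1 ≤ j → j ≤ m L → n - dimF L (r L j) = b L (j - 1) := fun j h1 hj => by
    have := hbsub (j - 1) (by omega)
    rwa [Nat.sub_add_cancel h1] at this
  have hbc : n - dimF L (height L) = b L (m L - 1) := hrm ▸ hbsub' (m L) h1m le_rfl
  have hb : b L (m L - 1) ≤ n := hbc ▸ Nat.sub_le _ _
  obtain ⟨Y, Q, Ψ, hQ, hY, hΨ0, hΨ⟩ := exists_adapted_chart h0 hL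
  obtain ⟨y, ε, hy, hsymm, hcube⟩ := exists_isCoordinates hΨ0 hΨ
  have hsymm' : (y.symm : (Fin n → ℝ) → (Fin n → ℝ)) = Ψ := funext hsymm
  have hleft : ∀ p ∈ y.source, Ψ (y p) = p := fun p hp => by
    rw [← hsymm]; exact y.left_inv hp
  have hpart : ∀ i p, partialVF y i p = fderiv ℝ Ψ (y p) (Pi.single i 1) := fun i p => by
    rw [partialVF, hsymm']
  have hkey := fun p (hp : p ∈ y.source) => (hcube (y p) (hy.mem_cube hp)).2.2.2
  have hspan : ∀ q, ∀ p ∈ y.source, V L q p =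
      Submodule.span ℝ {v | ∃ i : Fin n, n - dimF L q ≤ (i : ℕ) ∧ v = (Y i).1 p} := by
    intro q p hp
    have := (hkey p hp).2.1 q
    rwa [hleft p hp] at this
  have hker : ∀ q, ∀ p ∈ y.source, ∀ v, v ∈ V L q p ↔
      ∀ i : Fin n, (i : ℕ) < n - dimF L q → fderiv ℝ y p v i = 0 := by
    intro q p hp v
    have h1 := (hkey p hp).2.2 q (fderiv ℝ y p v)
    have h2 := hy.fderiv_symm_fderiv hp v
    rw [hsymm'] at h2
    rwa [hleft p hp, h2] at h1
  have hdiff : ∀ i, ∀ p ∈ y.source, (Y i).1 p - partialVF y i p ∈ V L (Q i + 1) p := by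
    intro i p hp
    have := (hkey p hp).1 i
    rw [hleft p hp, ← hpart] at this
    rw [← neg_sub]
    exact neg_mem this
  have hbot : ∀ q, height L + 1 ≤ q → ∀ p, V L q p = ⊥ := fun q hq p =>
    le_bot_iff.1 ((V_antitone p hq).trans (V_eq_bot ideal_height_add_one p).le)
  have hYmem : ∀ i : Fin n, b L (m L - 1) ≤ (i : ℕ) → Y i ∈ ideal L (height L) := fun i hi =>
    nilradicalSeries_antitone ((hQ i _).2 (hbc.trans_le hi)) (hY i)
  -- For these indices `Q i` is at least `k`, so the error `Y i - ∂_i` takes values in the zero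
  -- distribution of level `Q i + 1`.
  have hYeq : ∀ i : Fin n, b L (m L - 1) ≤ (i : ℕ) → ∀ p ∈ y.source,
      (Y i).1 p = partialVF y i p := by
    intro i hi p hp
    have h1 := hdiff i p hp
    rw [hbot _ (Nat.succ_le_succ ((hQ i _).2 (hbc.trans_le hi))), Submodule.mem_bot] at h1
    exact sub_eq_zero.1 h1
  have hsource : ∀ t ∈ cube n ε, Ψ t ∈ y.source ∧ y (Ψ t) = t := fun t ht => by
    have ht' : t ∈ y.target := by rw [hy.target_eq]; exact ht
    rw [← hsymm]
    exact ⟨y.map_target ht', y.right_inv ht'⟩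
  -- With the height a successor, the next ideal of the series unfolds to the bracket of the
  -- nilradical with `Lᵏ`.
  obtain ⟨k, hk⟩ : ∃ k, height L = k + 1 :=
    Nat.exists_eq_add_of_le' (one_le_height hn h0 hL)
  have hcomm : ∀ X ∈ ideal L 1, ∀ Z ∈ ideal L (height L), ⁅X, Z⁆ = 0 := by
    intro X hX Z hZ
    have h1 : ⁅X, Z⁆ ∈ ideal L (height L + 1) := by
      rw [hk] at hZ ⊢
      exact LieSubmodule.lie_mem_lie hX hZ
    rwa [ideal_height_add_one, LieSubmodule.mem_bot] at h1
  have hle1 : ideal L (height L) ≤ ideal L 1 := nilradicalSeries_antitone (by omega)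
  have H : FibredChart L (ideal L (height L)) Ψ Y (b L (m L - 1)) ε :=
    { le := hb
      contDiffAt := fun t ht => (hcube t ht).1
      isInvertible := fun t ht => (hcube t ht).2.1
      mem := fun t ht => (hcube t ht).2.2.1
      Y_mem := hYmem
      fderiv_eq := fun t ht i hi => by
        have h1 := hYeq i hi _ (hsource t ht).1
        rw [hpart, (hsource t ht).2] at h1
        exact h1.symm
      eq_zero := fun X hX t ht w hw i hi => by
        refine ((hcube t ht).2.2.2.2.2 (height L) w).1 ?_ i (hi.trans_eq hbc.symm)
        rw [hw]
        exact ⟨X, hX, rfl⟩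
      comm := fun X hX Z hZ => hcomm X (hle1 hX) Z hZ }
  have hform : ∀ X : L, ∀ p ∈ y.source, X.1 p =
      ∑ j ∈ Finset.univ.filter fun j : Fin n => b L (m L - 1) ≤ (j : ℕ),
        pull Ψ X (y p) j • partialVF y j p
      + ∑ i, H.projHom X (firstEntries hb (y p)) i • partialVF y (Fin.castLE hb i) p := by
    intro X p hp
    have h1 := H.fderiv_pull X (hy.mem_cube hp)
    rw [hleft p hp] at h1
    have h2 : X.1 p = ∑ j, pull Ψ X (y p) j • partialVF y j p := by
      rw [← h1]
      refine (congrArg _ (pi_eq_sum_univ' (pull Ψ X (y p)))).trans ?_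
      rw [map_sum]
      refine Finset.sum_congr rfl fun j _ => ?_
      rw [hpart]
      exact map_smul _ _ _
    rw [h2, ← Fin.sum_filter_add_sum_castLE hb]
    congr 1
    refine Finset.sum_congr rfl fun i _ => ?_
    exact congrArg (fun v : Fin _ → ℝ => v i • partialVF y (Fin.castLE hb i) p)
      (H.projVF_firstEntries X (hy.mem_cube hp)).symm
  refine ⟨y, ε, Y, hb, H.projHom, hy, ?_, ?_, ?_, ?_, ?_, ?_, ?_, ?_, ?_, ?_⟩
  · intro j hj p hp
    have hker' : ∀ p ∈ y.source, ∀ v, v ∈ V L (r L (j + 1)) p ↔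
        ∀ i : Fin n, (i : ℕ) < b L j → fderiv ℝ y p v i = 0 := by
      rw [← hbsub j (Finset.mem_Icc.1 hj).2]
      exact hker _
    exact ⟨hker' p hp, hy.leaf_eq hker' hp⟩
  · intro j hj p hp
    obtain ⟨hj1, hjm⟩ := Finset.mem_Icc.1 hj
    refine ⟨by rw [hspan _ p hp, hbsub' j hj1 hjm], fun i hi1 hi2 => ?_⟩
    have h1 : r L j ≤ Q i := (hQ i _).2 ((hbsub' j hj1 hjm).trans_le hi1)
    -- Equal dimensions at the origin select the same tail of the frame, hence the same distribution
    -- on the whole chart.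
    have h2 : V L (r L (j + 1)) p = V L (r L j + 1) p := by
      rw [hspan _ p hp, hspan _ p hp, dimF_r_add_one hhF hj1 hjm]
    rw [h2]
    exact V_antitone p (Nat.succ_le_succ h1) (hdiff i p hp)
  · intro p hp
    rw [hspan _ p hp, hbc]
  · exact fun i hi => ⟨hYmem i hi, hYeq i hi⟩
  · intro X
    -- The linear coefficients are the components of `[Y i, X]`, and the constant terms those of `X`
    -- where the fibre coordinates vanish.
    refine ⟨fun i j u => pull Ψ ⁅Y i, X⁆ (zeroExtend n _ u) j,
      fun j u => pull Ψ X (zeroExtend n _ u) j, fun i j => H.contDiffOn_pull_zeroExtend _ j,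
      fun j => H.contDiffOn_pull_zeroExtend _ j, fun p hp => ?_⟩
    rw [hform X p hp]
    congr 1
    refine Finset.sum_congr rfl fun j _ => ?_
    rw [H.pull_apply_eq_add_sum X (hy.mem_cube hp) j]
  · intro X hX
    refine ⟨fun j u => pull Ψ X (zeroExtend n _ u) j,
      fun j => H.contDiffOn_pull_zeroExtend _ j, fun p hp => ?_⟩
    rw [hform X p hp]
    congr 1
    refine Finset.sum_congr rfl fun j _ => ?_
    -- An element of `L¹` commutes with `Lᵏ`, so the linear coefficients vanish.
    rw [H.pull_apply_eq_of_forall_lie X j (fun t _ i hi => ?_) (hy.mem_cube hp)]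
    rw [← lie_skew, hcomm X hX _ (hYmem i hi), neg_zero, FibredChart.pull_zero, Pi.zero_apply]
  · infer_instance
  · exact Module.Finite.range H.projHom.toLinearMap
  · exact H.isTransitive_range hL
  · have h1 := b_succ (L := L) (m L - 1)
    have h2 := hbd (m L) le_rfl
    have h3 : dimF L (r L (m L + 1)) = 0 := by rw [r, if_neg (by omega), hhF]
    rw [Nat.sub_add_cancel h1m] at h1
    omega
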